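/- **Setting.** Let $\xi=(\xi_n)_{n\ge 1}$ be i.i.d. random variables on a probability space $(\Omega,\mathscr A,\mathbf P)$ (the environment); each value of $\xi_n$ determines the law $\mathcal L_n=\mathcal L(\xi_n)$ of a point process $L_n$ on $\mathbb R$. Given $\xi$ and $a\in\mathbb R$, let $\mathbb P_{\xi,a}$ be the law of the branching random walk that starts with one particle $\varnothing$ at position $a$ and in which each particle of generation $n\ge 0$ has, independently of all others, children displaced from it by the points of a copy of $L_{n+1}$. Write $|u|$ for the generation of a particle $u$, $V(u)$ for its position, $u_k$ for its ancestor in generation $k$, $\mathbb P_\xi=\mathbb P_{\xi,0}$, and $\mathbb E$ for the expectation under $\int\mathbb P_\xi(\cdot)\,d\mathbf P$. The law $\mathbb P_{\xi,a}$ lives on the space of marked trees with the $\sigma$-algebra $\mathscr F_\infty=\bigvee_n\mathscr F_n$, where (for fixed $\xi$) $\mathscr F_n$ is generated by the particles of generations at most $n$ and their positions. Assume that $$\mathbb P_\xi\Big(\sum_{|u|=1}1\ge1\Big)=1\ \ \mathbf P\text{-a.s.},\quad \mathbf P\Big[\mathbb P_\xi\Big(\sum_{|u|=1}1>1\Big)>0\Big]>0,\quad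 \mathbb E_\xi\Big[\sum_{|u|=1}\mathbf 1_{\{V(u)>0\}}e^{-V(u)}\Big]>0\ \ \mathbf P\text{-a.s.},$$ $$\log \mathbb E_\xi\Big[\sum_{|u|=1}e^{-V(u)}\Big]=\mathbb E_\xi\Big[\sum_{|u|=1}V(u)e^{-V(u)}\Big]=0\ \ \mathbf P\text{-a.s.},\qquad \mathbb E\Big[\sum_{|u|=1}|V(u)|^{2+\delta}e^{-V(u)}\Big]<\infty\ \text{ for some }\delta>0.$$ **Harmonic function.** Given $\xi$, let $S_n=X_1+\dots+X_n$ with independent $X_i$ of laws $\mu_i(B)=\mathbb E_\xi\big[\sum_{x\in L_i}\mathbf 1_B(x)e^{-x}\big]$, and for $y\ge0$ put $\tau_y=\inf\{n\ge1:y+S_n<0\}$ and $U(\xi,y)=\lim_{n\to\infty}\mathbb E_\xi[(y+S_n)\mathbf 1_{\{\tau_y>n\}}]$. Let $\theta^n\xi=(\xi_{n+1},\xi_{n+2},\dots)$. **Tilted measure.** For $\beta\ge0$ put, for a particle $v$ of generation $n$, $$D_n^{(\beta)}(v)=U(\theta^n\xi,V(v)+\beta)\,e^{-V(v)}\,\mathbf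 1_{\{\min_{0\le k\le n}V(v_k)\ge-\beta\}},\qquad D^{(\beta)}_n=\sum_{|v|=n}D^{(\beta)}_n(v).$$ $\mathbb Q^{(\beta)}_{\xi,a}$ denotes the probability measure on $\mathscr F_\infty$ with $$\frac{d\mathbb Q^{(\beta)}_{\xi,a}}{d\mathbb P_{\xi,a}}\Big|_{\mathscr F_n}=\frac{D_n^{(\beta)}}{U(\xi,a+\beta)e^{-a}}\quad\text{for all }n\ge1.$$ **Branching random walk with a spine.** It starts with one particle $w_0$, the spine particle of generation $0$, at position $a$. Given the first $n$ generations and the spine particle $w_n$ of generation $n$, all particles of generation $n$ reproduce independently. Each particle other than $w_n$ has children displaced from it by the points of a copy of $L_{n+1}$. The children of $w_n$, if it is at position $x$, are displaced from it by the points of a point process whose law has density $$\frac{\sum_{l\in L_{n+1}}U(\theta^{n+1}\xi,x+l+\beta)\,e^{-(x+l)}\,\mathbf 1_{\{x+l\ge-\beta\}}}{U(\theta^n\xi,x+\beta)\,e^{-x}}$$ with respect to $\mathcal L_{n+1}$ (so their positions have the law of the first generation under $\mathbb Q^{(\beta)}_{\theta^n\xi,x}$). Then $w_{n+1}$ is chosen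 among the children $v$ of $w_n$ with probability proportional to $D_{n+1}^{(\beta)}(v)$. Let $\hat{\mathbb P}^{(\beta)}_{\xi,a}$ be the law of the pair (marked tree, $(w_n)_{n\ge0}$). **Proposition (Spinal decomposition).** For $\mathbf P$-almost every $\xi$ and all $\beta\ge0$, $a\ge0$: the measure $\mathbb Q^{(\beta)}_{\xi,a}$ exists and is unique, and it is equal to the marginal law of $\hat{\mathbb P}^{(\beta)}_{\xi,a}$ on the space of marked trees. -/

import Mathlib

open MeasureTheory ProbabilityTheory Filter
open scoped ENNReal

namespace BRW

noncomputable section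

/-! ### Point processes and marked trees -/

/-- `Option ℝ` is the disjoint union of `ℝ` and one extra point `none`. -/
instance instMeasurableSpaceOptionReal : MeasurableSpace (Option ℝ) :=
  MeasurableSpace.map some inferInstance

/-- A (labelled) point configuration: `c k = some x` means that the `k`-th child exists and is
displaced by `x` from its parent, `c k = none` means that there is no `k`-th child. Finitely or
countably many children are allowed. -/
abbrev Offspring : Type := ℕ → Option ℝ

/-- Ulam–Harris labels. The most recent label is written first: the children of `u` are the
`k :: u`, the ancestors of `u` (including `u` and the root `[]`) are its suffixes, and the
generation of `u` is `u.length`. -/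
abbrev Vertex : Type := List ℕ

instance instMeasurableSpaceVertex : MeasurableSpace Vertex := ⊤

/-- A marked tree: `V u = some x` means that `u` belongs to the tree and has position `x`. The
σ-algebra is the product one, that is, the one generated by all the `V u`. -/
abbrev MarkedTree : Type := Vertex → Option ℝ

/-- `∑_{x ∈ c} f x`, the sum over the points of the configuration `c`. -/
def childSum (f : ℝ → ℝ≥0∞) (c : Offspring) : ℝ≥0∞ := ∑' k, (c k).elim 0 f

theorem measurable_of_some {β : Type*} [MeasurableSpace β] {f : Option ℝ → β}
    (hf : Measurable fun x : ℝ => f (some x)) : Measurable f := fun _ ht => hf ht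

theorem measurable_some : Measurable (some : ℝ → Option ℝ) := fun _ hs => hs

theorem measurable_optionElim {f : ℝ → ℝ≥0∞} (hf : Measurable f) :
    Measurable fun o : Option ℝ => o.elim 0 f := measurable_of_some hf

theorem measurable_getD : Measurable fun o : Option ℝ => o.getD 0 :=
  measurable_of_some measurable_id

/-- A set of `Option ℝ` of the form `{none}` is measurable, and so is its complement. -/
theorem measurableSet_none : MeasurableSet ({none} : Set (Option ℝ)) := by
  change MeasurableSet (some ⁻¹' ({none} : Set (Option ℝ)))
  convert MeasurableSet.empty
  ext x
  simp

theorem measurable_option_prod {α β : Type*} [MeasurableSpace α] [MeasurableSpace β]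
    {f : Option ℝ × α → β} (h₁ : Measurable fun p : ℝ × α => f (some p.1, p.2))
    (h₂ : Measurable fun a : α => f (none, a)) : Measurable f := by
  have e : f = fun q : Option ℝ × α =>
      if q.1 ∈ ({none} : Set (Option ℝ)) then f (none, q.2) else f (some (q.1.getD 0), q.2) := by
    funext q
    rcases q with ⟨_ | x, a⟩ <;> simp
  rw [e]
  refine Measurable.ite (measurable_fst measurableSet_none) (h₂.comp measurable_snd) ?_
  exact h₁.comp ((measurable_getD.comp measurable_fst).prodMk measurable_snd)

theorem measurable_childSum {f : ℝ → ℝ≥0∞} (hf : Measurable f) : Measurable (childSum f) :=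
  Measurable.tsum fun k => (measurable_optionElim hf).comp (measurable_pi_apply k)

/-- Position of a potential child: `none` unless the parent and the child both exist. -/
def childPos (p d : Option ℝ) : Option ℝ := p.bind fun x => d.map fun l => x + l

theorem measurable_childPos : Measurable fun q : Option ℝ × Option ℝ => childPos q.1 q.2 := by
  refine measurable_option_prod ?_ measurable_const
  have : Measurable fun q : Option ℝ × ℝ => q.1.map fun l => q.2 + l :=
    measurable_option_prod
      (measurable_some.comp (measurable_snd.add measurable_fst)) measurable_const
  exact this.comp measurable_swap

variable {E : Type*} [MeasurableSpace E]

/-! ### The branching random walk in a fixed environment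

The environment is `s : ℕ → E`; the particles of generation `n` reproduce according to the point
process law `𝓛 (s n)`. -/

/-- The shifted environment `θⁿ s`. -/
def shift (n : ℕ) (s : ℕ → E) : ℕ → E := fun i => s (i + n)

/-- The marked tree obtained from the initial position `a` and the offspring `L u` of all `u`. -/
def treeOf (a : ℝ) (L : Vertex → Offspring) : MarkedTree
  | [] => some a
  | k :: u => childPos (treeOf a L u) (L u k)

theorem measurable_treeOf (a : ℝ) : Measurable (treeOf a) := by
  refine measurable_pi_lambda _ fun u => ?_
  induction u with
  | nil => exact measurable_const
  | cons k u ih =>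
    exact measurable_childPos.comp (ih.prodMk
      ((measurable_pi_apply k).comp (measurable_pi_apply u)))

/-- The quenched law of the branching random walk started from one particle at `a`, as a law on
marked trees: all potential individuals reproduce independently. -/
def brwLaw (𝓛 : Kernel E Offspring) (s : ℕ → E) (a : ℝ) : Measure MarkedTree :=
  (Measure.infinitePi fun u : Vertex => 𝓛 (s u.length)).map (treeOf a)

/-! ### The associated random walk and the harmonic function -/

/-- `μ(B) = E[∑_{x ∈ L} 1_B(x) e^{-x}]` where `L` has law `𝓛 e`. -/
def stepLaw (𝓛 : Kernel E Offspring) (e : E) : Measure ℝ :=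
  Measure.ofMeasurable
    (fun B _ => ∫⁻ c, childSum (B.indicator fun x => ENNReal.ofReal (Real.exp (-x))) c ∂𝓛 e)
    (by
      have h : childSum ((∅ : Set ℝ).indicator fun x => ENNReal.ofReal (Real.exp (-x))) =
          fun _ => 0 := by
        funext c
        refine ENNReal.tsum_eq_zero.2 fun k => ?_
        cases c k <;> simp
      rw [h, lintegral_zero])
    (by
      intro B hB hd
      have hm : ∀ i, Measurable ((B i).indicator fun x : ℝ => ENNReal.ofReal (Real.exp (-x))) :=
        fun i => Measurable.indicator (by fun_prop) (hB i)
      rw [← lintegral_tsum fun i => (measurable_childSum (hm i)).aemeasurable]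
      refine lintegral_congr fun c => ?_
      simp only [childSum]
      rw [ENNReal.tsum_comm]
      refine tsum_congr fun k => ?_
      cases c k with
      | none => simp
      | some x =>
        change (⋃ i, B i).indicator (fun x => ENNReal.ofReal (Real.exp (-x))) x =
          ∑' i, (B i).indicator (fun x => ENNReal.ofReal (Real.exp (-x))) x
        by_cases hx : ∃ i, x ∈ B i
        · obtain ⟨i, hi⟩ := hx
          rw [Set.indicator_of_mem (Set.mem_iUnion.2 ⟨i, hi⟩), tsum_eq_single i,
            Set.indicator_of_mem hi]
          intro j hj
          exact Set.indicator_of_notMem (fun h => Set.disjoint_left.1 (hd hj) h hi) _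
        · push Not at hx
          rw [Set.indicator_of_notMem (by simpa using hx)]
          exact (ENNReal.tsum_eq_zero.2 fun i => Set.indicator_of_notMem (hx i) _).symm)

/-- The law of the independent increments `X₁, X₂, …` of the random walk in the environment. -/
def walkLaw (𝓛 : Kernel E Offspring) (s : ℕ → E) : Measure (ℕ → ℝ) :=
  Measure.infinitePi fun i => stepLaw 𝓛 (s i)

/-- The walk started from `0` with increments `x`. -/
def walk (x : ℕ → ℝ) (n : ℕ) : ℝ := ∑ i ∈ Finset.range n, x i

/-- `U_n(s, y) = E[(y + S_n) 1{τ_y > n}]`, where `τ_y` is the first `k ≥ 1` with `y + S_k < 0`. -/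
def harmonicApprox (𝓛 : Kernel E Offspring) (s : ℕ → E) (n : ℕ) (y : ℝ) : ℝ≥0∞ :=
  ∫⁻ x, {x : ℕ → ℝ | ∀ k, 1 ≤ k → k ≤ n → 0 ≤ y + walk x k}.indicator
    (fun x => ENNReal.ofReal (y + walk x n)) x ∂walkLaw 𝓛 s

/-- The quenched harmonic function `U(s, y) = lim_n U_n(s, y)`; the limit is written as a `limsup`,
which has a value in all cases. -/
def harmonic (𝓛 : Kernel E Offspring) (s : ℕ → E) (y : ℝ) : ℝ≥0∞ :=
  limsup (fun n => harmonicApprox 𝓛 s n y) atTop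

theorem monotone_harmonic (𝓛 : Kernel E Offspring) (s : ℕ → E) : Monotone (harmonic 𝓛 s) := by
  intro y z hyz
  refine limsup_le_limsup (Eventually.of_forall fun n => lintegral_mono fun x => ?_)
  refine (Set.indicator_le_indicator_of_subset ?_ (fun _ => bot_le) x).trans
    (Set.indicator_le_indicator (ENNReal.ofReal_le_ofReal (by linarith)))
  intro x hx k h1 h2
  have := hx k h1 h2
  linarith

theorem measurable_harmonic (𝓛 : Kernel E Offspring) (s : ℕ → E) :
    Measurable (harmonic 𝓛 s) := (monotone_harmonic 𝓛 s).measurable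

/-! ### The truncated derivative martingale and the change of measure -/

/-- `u` and all its ancestors are in the tree and have positions at least `-β`. -/
def StaysAbove (β : ℝ) (V : MarkedTree) (u : Vertex) : Prop :=
  ∀ v, v <:+ u → ∃ x, V v = some x ∧ -β ≤ x

open Classical in
/-- `U(θ^{|u|} s, V(u) + β) e^{-V(u)} 1{min_{k ≤ |u|} V(u_k) ≥ -β}`, and `0` if `u` is not in
the tree. -/
def vertexWeight (𝓛 : Kernel E Offspring) (s : ℕ → E) (β : ℝ) (V : MarkedTree) (u : Vertex) :
    ℝ≥0∞ :=
  if StaysAbove β V u then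
    harmonic 𝓛 (shift u.length s) ((V u).getD 0 + β)
      * ENNReal.ofReal (Real.exp (-(V u).getD 0))
  else 0

/-- The truncated derivative martingale `D_n^{(β)}`. -/
def truncMart (𝓛 : Kernel E Offspring) (s : ℕ → E) (β : ℝ) (n : ℕ) (V : MarkedTree) : ℝ≥0∞ :=
  ∑' u : {u : Vertex // u.length = n}, vertexWeight 𝓛 s β V u

/-- `U(s, a + β) e^{-a}`, the initial value of the truncated derivative martingale. -/
def initValue (𝓛 : Kernel E Offspring) (s : ℕ → E) (β a : ℝ) : ℝ≥0∞ :=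
  harmonic 𝓛 s (a + β) * ENNReal.ofReal (Real.exp (-a))

/-- The σ-algebra generated by the first `n` generations. -/
abbrev genSigma (n : ℕ) : MeasurableSpace MarkedTree :=
  cylinderEvents {u : Vertex | u.length ≤ n}

/-- `Q` is the tilted law: a probability measure on marked trees whose density on the first `n`
generations with respect to the branching random walk started at `a` is
`D_n^{(β)} / (U(s, a + β) e^{-a})`, for all `n ≥ 1`. -/
structure IsTiltedLaw (𝓛 : Kernel E Offspring) (s : ℕ → E) (β a : ℝ) (Q : Measure MarkedTree) :
    Prop where
  isProbabilityMeasure : IsProbabilityMeasure Q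
  density : ∀ n, 1 ≤ n → ∀ A, MeasurableSet[genSigma n] A →
    Q A = ∫⁻ V in A, truncMart 𝓛 s β n V / initValue 𝓛 s β a ∂brwLaw 𝓛 s a

/-! ### The branching random walk with a spine -/

/-- `U(θ^{n+1} s, y + β) e^{-y} 1{y ≥ -β}`, with `y = x + l` the position of a child. -/
def childWeight (𝓛 : Kernel E Offspring) (s : ℕ → E) (β : ℝ) (n : ℕ) (x l : ℝ) : ℝ≥0∞ :=
  if -β ≤ x + l then
    harmonic 𝓛 (shift (n + 1) s) (x + l + β) * ENNReal.ofReal (Real.exp (-(x + l)))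
  else 0

/-- The size-biasing density `D_1^{(β)} / D_0^{(β)}`, in the environment `θⁿ s`, of the offspring
of a particle of generation `n` at position `x`. -/
def biasDensity (𝓛 : Kernel E Offspring) (s : ℕ → E) (β : ℝ) (n : ℕ) (x : ℝ) (c : Offspring) :
    ℝ≥0∞ :=
  childSum (childWeight 𝓛 s β n x) c / initValue 𝓛 (shift n s) β x

theorem measurable_childWeight (𝓛 : Kernel E Offspring) (s : ℕ → E) (β : ℝ) (n : ℕ) :
    Measurable (Function.uncurry (childWeight 𝓛 s β n)) := by
  have h := measurable_harmonic 𝓛 (shift (n + 1) s)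
  refine Measurable.ite (measurableSet_le measurable_const (by fun_prop)) ?_ measurable_const
  exact (h.comp (by fun_prop)).mul (by fun_prop)

theorem measurable_biasDensity (𝓛 : Kernel E Offspring) (s : ℕ → E) (β : ℝ) (n : ℕ) :
    Measurable (Function.uncurry (biasDensity 𝓛 s β n)) := by
  refine Measurable.div (Measurable.tsum fun k => ?_) ?_
  · have h : Measurable fun q : Option ℝ × ℝ => q.1.elim 0 (childWeight 𝓛 s β n q.2) :=
      measurable_option_prod
        ((measurable_childWeight 𝓛 s β n).comp measurable_swap) measurable_const
    have h' : Measurable fun p : ℝ × Offspring => (p.2 k, p.1) :=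
      ((measurable_pi_apply k).comp measurable_snd).prodMk measurable_fst
    exact h.comp h'
  · have h := measurable_harmonic 𝓛 (shift n s)
    exact (h.comp (by fun_prop)).mul (by fun_prop)

theorem measurable_vertexWeight (𝓛 : Kernel E Offspring) (s : ℕ → E) (β : ℝ) (u : Vertex) :
    Measurable fun V : MarkedTree => vertexWeight 𝓛 s β V u := by
  have h := measurable_harmonic 𝓛 (shift u.length s)
  have hg : Measurable fun V : MarkedTree => (V u).getD 0 :=
    measurable_getD.comp (measurable_pi_apply u)
  refine Measurable.ite ?_ ?_ measurable_const
  · have hs : MeasurableSet {o : Option ℝ | ∃ x, o = some x ∧ -β ≤ x} := by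
      change MeasurableSet (some ⁻¹' {o : Option ℝ | ∃ x, o = some x ∧ -β ≤ x})
      convert (measurableSet_Ici : MeasurableSet (Set.Ici (-β))) using 1
      ext x
      simp
    have e : {V : MarkedTree | StaysAbove β V u} = ⋂ v : Vertex, ⋂ _ : v <:+ u,
        (fun V : MarkedTree => V v) ⁻¹' {o : Option ℝ | ∃ x, o = some x ∧ -β ≤ x} := by
      ext V
      simp [StaysAbove]
    rw [e]
    exact MeasurableSet.iInter fun v => MeasurableSet.iInter fun _ => measurable_pi_apply v hs
  · exact (h.comp (hg.add_const β)).mul (by fun_prop)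

/-- The positions `x` for which the size-biasing density has total mass one. -/
def massOne (𝓛 : Kernel E Offspring) (s : ℕ → E) (β : ℝ) (n : ℕ) : Set ℝ :=
  {x | ∫⁻ c, biasDensity 𝓛 s β n x c ∂𝓛 (s n) = 1}

theorem measurableSet_massOne (𝓛 : Kernel E Offspring) (s : ℕ → E) (β : ℝ) (n : ℕ)
    [IsMarkovKernel 𝓛] : MeasurableSet (massOne 𝓛 s β n) :=
  (measurable_biasDensity 𝓛 s β n).lintegral_prod_right (measurableSet_singleton 1)

open Classical in
/-- The law of the offspring of a spine particle of generation `n` as a function of its position.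
The second case only serves to have a probability measure in all cases: it is used where the
size-biasing density does not have total mass one. -/
def biasedOffspring (𝓛 : Kernel E Offspring) (s : ℕ → E) (β : ℝ) (n : ℕ) [IsMarkovKernel 𝓛] :
    Kernel ℝ Offspring :=
  Kernel.piecewise (measurableSet_massOne 𝓛 s β n)
    (Kernel.withDensity (Kernel.const ℝ (𝓛 (s n))) (biasDensity 𝓛 s β n))
    (Kernel.const ℝ (𝓛 (s n)))

instance (𝓛 : Kernel E Offspring) (s : ℕ → E) (β : ℝ) (n : ℕ) [IsMarkovKernel 𝓛] :
    IsMarkovKernel (biasedOffspring 𝓛 s β n) := by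
  classical
  refine ⟨fun x => ⟨?_⟩⟩
  rw [biasedOffspring, Kernel.piecewise_apply]
  split_ifs with hx
  · rw [Kernel.withDensity_apply _ (measurable_biasDensity 𝓛 s β n)]
    simpa [massOne] using hx
  · simp

/-- Total weight of the children of `w`. -/
def totalWeight (𝓛 : Kernel E Offspring) (s : ℕ → E) (β : ℝ) (p : MarkedTree × Vertex) : ℝ≥0∞ :=
  ∑' j, vertexWeight 𝓛 s β p.1 (j :: p.2)

open Classical in
/-- The probability that the `k`-th child of `w` is chosen as the next spine particle in the tree
`V`: proportional to its weight. (If all weights vanish or their sum is infinite, which has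
probability zero, the choice is arbitrary.) -/
def pickProb (𝓛 : Kernel E Offspring) (s : ℕ → E) (β : ℝ) (p : MarkedTree × Vertex) (k : ℕ) :
    ℝ≥0∞ :=
  if totalWeight 𝓛 s β p = 0 ∨ totalWeight 𝓛 s β p = ∞ then
    if k = 0 then 1 else 0
  else vertexWeight 𝓛 s β p.1 (k :: p.2) / totalWeight 𝓛 s β p

theorem measurable_childVertexWeight (𝓛 : Kernel E Offspring) (s : ℕ → E) (β : ℝ) (k : ℕ) :
    Measurable fun p : MarkedTree × Vertex => vertexWeight 𝓛 s β p.1 (k :: p.2) :=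
  measurable_from_prod_countable_left fun w => measurable_vertexWeight 𝓛 s β (k :: w)

theorem measurable_pickProb (𝓛 : Kernel E Offspring) (s : ℕ → E) (β : ℝ) (k : ℕ) :
    Measurable fun p => pickProb 𝓛 s β p k := by
  have ht : Measurable (totalWeight 𝓛 s β) :=
    Measurable.tsum fun j => measurable_childVertexWeight 𝓛 s β j
  refine Measurable.ite ?_ measurable_const ((measurable_childVertexWeight 𝓛 s β k).div ht)
  exact (ht (measurableSet_singleton 0)).union (ht (measurableSet_singleton ∞))

/-- The choice of the label of the next spine particle, as a kernel. -/
def pickKernel (𝓛 : Kernel E Offspring) (s : ℕ → E) (β : ℝ) : Kernel (MarkedTree × Vertex) ℕ where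
  toFun p := Measure.sum fun k => pickProb 𝓛 s β p k • Measure.dirac k
  measurable' := by
    refine Measure.measurable_of_measurable_coe _ fun t ht => ?_
    simp only [Measure.sum_apply _ ht, Measure.smul_apply, smul_eq_mul]
    exact Measurable.tsum fun k => (measurable_pickProb 𝓛 s β k).mul_const _

instance (𝓛 : Kernel E Offspring) (s : ℕ → E) (β : ℝ) : IsMarkovKernel (pickKernel 𝓛 s β) := by
  refine ⟨fun p => ⟨?_⟩⟩
  change (Measure.sum fun k => pickProb 𝓛 s β p k • Measure.dirac k) Set.univ = 1
  simp only [Measure.sum_apply _ MeasurableSet.univ, Measure.smul_apply, measure_univ,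
    smul_eq_mul, mul_one, pickProb]
  by_cases h : totalWeight 𝓛 s β p = 0 ∨ totalWeight 𝓛 s β p = ∞
  · simp [h]
  · simp only [h, if_false, div_eq_mul_inv]
    rw [ENNReal.tsum_mul_right]
    rw [not_or] at h
    exact ENNReal.mul_inv_cancel h.1 h.2

/-- Add generation `n + 1` to the tree `V`, the offspring of `u` being `c u`. -/
def grow (n : ℕ) (V : MarkedTree) (c : Vertex → Offspring) : MarkedTree
  | [] => V []
  | k :: u => if u.length = n then childPos (V u) (c u k) else V (k :: u)

/-- Add generation `n + 1` to the tree: the spine particle `w` has offspring `d`, every other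
particle `u` has offspring `c u`. -/
def growSpine (n : ℕ) (q : (MarkedTree × Vertex) × (Vertex → Offspring) × Offspring) :
    MarkedTree × Vertex :=
  (grow n q.1.1 (Function.update q.2.1 q.1.2 q.2.2), q.1.2)

theorem measurable_growSpine (n : ℕ) : Measurable (growSpine n) := by
  refine Measurable.prodMk (measurable_pi_lambda _ fun u => ?_) (by fun_prop)
  cases u with
  | nil => exact (measurable_pi_apply _).comp (measurable_fst.comp measurable_fst)
  | cons k u =>
    simp only [grow]
    split_ifs
    · refine measurable_childPos.comp (Measurable.prodMk ?_ ?_)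
      · exact (measurable_pi_apply _).comp (measurable_fst.comp measurable_fst)
      · refine (measurable_pi_apply k).comp ?_
        have e : (fun q : (MarkedTree × Vertex) × (Vertex → Offspring) × Offspring =>
            Function.update q.2.1 q.1.2 q.2.2 u) =
            fun q => if q.1.2 ∈ ({u} : Set Vertex) then q.2.2 else q.2.1 u := by
          funext q
          by_cases h : q.1.2 = u
          · subst h; simp
          · simp [h, Function.update_of_ne (Ne.symm h)]
        have hm : Measurable fun q : (MarkedTree × Vertex) × (Vertex → Offspring) × Offspring =>
            if q.1.2 ∈ ({u} : Set Vertex) then q.2.2 else q.2.1 u :=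
          Measurable.ite ((measurable_snd.comp measurable_fst) trivial) (by fun_prop)
            (by fun_prop)
        rw [← e] at hm
        exact hm
    · exact (measurable_pi_apply _).comp (measurable_fst.comp measurable_fst)

theorem measurable_spinePos :
    Measurable fun p : MarkedTree × Vertex => (p.1 p.2).getD 0 :=
  measurable_from_prod_countable_left fun w => measurable_getD.comp (measurable_pi_apply w)

/-- From the first `n` generations and the spine particle `w` of generation `n` to the first
`n + 1` generations: normal particles reproduce independently with law `𝓛 (s n)`, the spine
particle independently with the size-biased law attached to its position. -/
def reproKernel (𝓛 : Kernel E Offspring) (s : ℕ → E) (β : ℝ) (n : ℕ) [IsMarkovKernel 𝓛] :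
    Kernel (MarkedTree × Vertex) (MarkedTree × Vertex) :=
  (Kernel.id ×ₖ
    (Kernel.const _ (Measure.infinitePi fun _ : Vertex => 𝓛 (s n)) ×ₖ
      (biasedOffspring 𝓛 s β n).comap _ measurable_spinePos)).map (growSpine n)

instance (𝓛 : Kernel E Offspring) (s : ℕ → E) (β : ℝ) (n : ℕ) [IsMarkovKernel 𝓛] :
    IsMarkovKernel (reproKernel 𝓛 s β n) :=
  Kernel.IsMarkovKernel.map _ (measurable_growSpine n)

theorem measurable_nextSpine :
    Measurable fun q : (MarkedTree × Vertex) × ℕ => (q.1.1, q.2 :: q.1.2) := by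
  have : Measurable fun r : Vertex × ℕ => r.2 :: r.1 := measurable_of_countable _
  have h' : Measurable fun q : (MarkedTree × Vertex) × ℕ => (q.1.2, q.2) := by fun_prop
  exact Measurable.prodMk (by fun_prop) (this.comp h')

/-- One step of the branching random walk with a spine: reproduction, then choice of the next spine
particle among the children of the current one. -/
def spineStep (𝓛 : Kernel E Offspring) (s : ℕ → E) (β : ℝ) (n : ℕ) [IsMarkovKernel 𝓛] :
    Kernel (MarkedTree × Vertex) (MarkedTree × Vertex) :=
  ((Kernel.id ×ₖ pickKernel 𝓛 s β) ∘ₖ reproKernel 𝓛 s β n).map fun q => (q.1.1, q.2 :: q.1.2)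

instance (𝓛 : Kernel E Offspring) (s : ℕ → E) (β : ℝ) (n : ℕ) [IsMarkovKernel 𝓛] :
    IsMarkovKernel (spineStep 𝓛 s β n) :=
  Kernel.IsMarkovKernel.map _ measurable_nextSpine

/-- The tree reduced to its root, at position `a`. -/
def rootTree (a : ℝ) : MarkedTree
  | [] => some a
  | _ :: _ => none

/-- The law of the Markov chain (first `n` generations, spine particle of generation `n`), `n ≥ 0`,
started from the root at position `a`. -/
def spineChain (𝓛 : Kernel E Offspring) (s : ℕ → E) (β a : ℝ) [IsMarkovKernel 𝓛] :
    Measure (ℕ → MarkedTree × Vertex) :=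
  Kernel.trajMeasure (X := fun _ => MarkedTree × Vertex) (Measure.dirac (rootTree a, []))
    fun n => (spineStep 𝓛 s β n).comap (fun h => h ⟨n, Finset.mem_Iic.2 le_rfl⟩)
      (measurable_pi_apply _)

/-- The whole marked tree and the whole spine, from the chain of successive generations. -/
def assemble (p : ℕ → MarkedTree × Vertex) : MarkedTree × (ℕ → Vertex) :=
  (fun u => (p u.length).1 u, fun n => (p n).2)

theorem measurable_assemble : Measurable assemble := by
  refine Measurable.prodMk (measurable_pi_lambda _ fun u => ?_) (measurable_pi_lambda _ fun n => ?_)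
  · exact (measurable_pi_apply u).comp (measurable_fst.comp (measurable_pi_apply _))
  · exact measurable_snd.comp (measurable_pi_apply n)

/-- The law of the branching random walk with a spine, on the product of the space of marked trees
and the space of infinite spines. -/
def spineLaw (𝓛 : Kernel E Offspring) (s : ℕ → E) (β a : ℝ) [IsMarkovKernel 𝓛] :
    Measure (MarkedTree × (ℕ → Vertex)) :=
  (spineChain 𝓛 s β a).map assemble

end

end BRW

/-! The tilted law is not built by an extension theorem: the tree marginal of the spine process is
shown to have the required densities, which gives existence. Uniqueness is a π-system argument
(`IsTiltedLaw.unique`), since the densities fix the law on every finite number of generations.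

The densities come from a formula for the spine chain (`lintegral_spineChain`): the joint law of the
first `n` generations and `w_n` has density `D_n(u) / D_0` with respect to the branching random walk
times counting measure on the vertices `u` of generation `n`. It is proved by induction on `n`. In
one step (`vertexWeight_mul_lintegral_spineStep`) the denominator of the size-biasing density
cancels `D_n(u)`, and its numerator cancels the normalisation in the choice of `w_{n+1}`, which
leaves the weights `D_{n+1}` of the children of `u`. Summing over `u` forgets the spine and leaves
`D_n / D_0`.

These cancellations need `0 < U < ∞`, and the biased offspring law is a probability only if `U` is
harmonic for the walk killed below `0`. Since `U_n(y) = E[y + S_n; τ_y > n]` increases in `n`,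
harmonicity is monotone convergence (`CenteredEnv.stepOp_harmonic`), and positivity holds because
upward steps have positive probability.

Finiteness is the analytic part; it is proved for a fixed environment (`exists_bound_walkOp_Ici`).
With `b_n = n^p` and `p < 1/2`, put `W_n = E[y + S_n + b_n; τ_y > n]`. The increase of `W_n` in one
step is at most `P(τ_y > n)` times the increment of `b` plus a moment term for jumps larger than
`b_{n+1}`. Association of increasing functions gives `P(τ_y > n) E[(y + S_n)⁺] ≤ E[y + S_n; τ_y > n]
≤ W_n`, and `E[S_n⁺] ≥ c √n` follows from a convexity argument with `√(l² + z²)`, which uses only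
truncated second moments. Hence `W_{n+1} ≤ W_n (1 + a_n)` with `∑ a_n < ∞`. For almost every
environment, the moment assumption makes this series converge and the strong law makes the truncated
variances grow linearly. -/

namespace BRW

noncomputable section

/-! ### Transition operators of an inhomogeneous random walk, possibly killed outside a set -/

/-- One step of a random walk with increment law `ν` that is killed outside `K`. -/
def stepOp (K : Set ℝ) (ν : Measure ℝ) (f : ℝ → ℝ≥0∞) (y : ℝ) : ℝ≥0∞ :=
  ∫⁻ x, K.indicator f (y + x) ∂ν

/-- `E[f(y + S_n); y + S_k ∈ K for 1 ≤ k ≤ n]`, for independent increments of laws `μ 0, μ 1, …`. -/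
def walkOp (K : Set ℝ) : ℕ → (ℕ → Measure ℝ) → (ℝ → ℝ≥0∞) → ℝ → ℝ≥0∞
  | 0, _, f => f
  | n + 1, μ, f => stepOp K (μ 0) (walkOp K n (fun i => μ (i + 1)) f)

theorem stepOp_mono {K : Set ℝ} {ν : Measure ℝ} {f g : ℝ → ℝ≥0∞} (h : ∀ z ∈ K, f z ≤ g z)
    (y : ℝ) : stepOp K ν f y ≤ stepOp K ν g y := by
  refine lintegral_mono fun x => ?_
  by_cases hx : y + x ∈ K
  · simpa [hx] using h _ hx
  · simp [hx]

theorem walkOp_mono {K : Set ℝ} {f g : ℝ → ℝ≥0∞} (h : ∀ z ∈ K, f z ≤ g z) (n : ℕ) :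
    ∀ (μ : ℕ → Measure ℝ), ∀ y ∈ K, walkOp K n μ f y ≤ walkOp K n μ g y := by
  induction n with
  | zero => exact fun μ y hy => h y hy
  | succ n ih => exact fun μ y _ => stepOp_mono (ih _) y

/-- The definition peels off the first increment, which suits the harmonic function; here the last
one is peeled off, so that one-step estimates become estimates along `n`. -/
theorem walkOp_succ (K : Set ℝ) (n : ℕ) (f : ℝ → ℝ≥0∞) : ∀ μ : ℕ → Measure ℝ,
    walkOp K (n + 1) μ f = walkOp K n μ (stepOp K (μ n) f) := by
  induction n with
  | zero => exact fun μ => rfl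
  | succ n ih =>
    intro μ
    rw [walkOp, ih]
    rfl

theorem measurable_stepOp {K : Set ℝ} (hK : MeasurableSet K) (ν : Measure ℝ) [SFinite ν]
    {f : ℝ → ℝ≥0∞} (hf : Measurable f) : Measurable (stepOp K ν f) := by
  have h : Measurable fun p : ℝ × ℝ => K.indicator f (p.1 + p.2) :=
    (hf.indicator hK).comp (by fun_prop)
  exact h.lintegral_prod_right'

theorem stepOp_add {K : Set ℝ} (hK : MeasurableSet K) (ν : Measure ℝ) {f : ℝ → ℝ≥0∞}
    (hf : Measurable f) (g : ℝ → ℝ≥0∞) :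
    stepOp K ν (fun z => f z + g z) = fun y => stepOp K ν f y + stepOp K ν g y := by
  funext y
  have hm : Measurable fun x => K.indicator f (y + x) := (hf.indicator hK).comp (by fun_prop)
  rw [stepOp, stepOp, stepOp, ← lintegral_add_left hm]
  refine lintegral_congr fun x => ?_
  by_cases hx : y + x ∈ K <;> simp [hx]

theorem stepOp_const_mul {K : Set ℝ} (hK : MeasurableSet K) (ν : Measure ℝ) {f : ℝ → ℝ≥0∞}
    (hf : Measurable f) (c : ℝ≥0∞) :
    stepOp K ν (fun z => c * f z) = fun y => c * stepOp K ν f y := by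
  funext y
  have hm : Measurable fun x => K.indicator f (y + x) := (hf.indicator hK).comp (by fun_prop)
  rw [stepOp, stepOp, ← lintegral_const_mul c hm]
  refine lintegral_congr fun x => ?_
  by_cases hx : y + x ∈ K <;> simp [hx]

section Walk

variable {K : Set ℝ} {f g : ℝ → ℝ≥0∞}

theorem measurable_walkOp (hK : MeasurableSet K) (hf : Measurable f) (n : ℕ) :
    ∀ (μ : ℕ → Measure ℝ) [∀ i, SFinite (μ i)], Measurable (walkOp K n μ f) := by
  induction n with
  | zero => exact fun μ _ => hf
  | succ n ih => exact fun μ _ => measurable_stepOp hK _ (ih _)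

theorem walkOp_add (hK : MeasurableSet K) (hf : Measurable f) (g : ℝ → ℝ≥0∞) (n : ℕ) :
    ∀ (μ : ℕ → Measure ℝ) [∀ i, SFinite (μ i)],
    walkOp K n μ (fun z => f z + g z) = fun y => walkOp K n μ f y + walkOp K n μ g y := by
  induction n with
  | zero => exact fun μ _ => rfl
  | succ n ih =>
    intro μ _
    rw [walkOp, ih, stepOp_add hK _ (measurable_walkOp hK hf _ _)]
    rfl

theorem walkOp_const_mul (hK : MeasurableSet K) (hf : Measurable f) (c : ℝ≥0∞) (n : ℕ) :
    ∀ (μ : ℕ → Measure ℝ) [∀ i, SFinite (μ i)],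
    walkOp K n μ (fun z => c * f z) = fun y => c * walkOp K n μ f y := by
  induction n with
  | zero => exact fun μ _ => rfl
  | succ n ih =>
    intro μ _
    rw [walkOp, ih, stepOp_const_mul hK _ (measurable_walkOp hK hf _ _)]
    rfl

theorem walkOp_one_le (n : ℕ) : ∀ (μ : ℕ → Measure ℝ) [∀ i, IsProbabilityMeasure (μ i)] (y : ℝ),
    walkOp K n μ (fun _ => 1) y ≤ 1 := by
  induction n with
  | zero => exact fun μ _ y => le_rfl
  | succ n ih =>
    intro μ _ y
    calc _ ≤ ∫⁻ _, 1 ∂μ 0 := lintegral_mono fun x =>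
            Set.indicator_le (s := K) (g := fun _ => 1) (fun z _ => ih _ z) (y + x)
      _ = 1 := by simp

theorem walkOp_univ_const (n : ℕ) (c : ℝ≥0∞) :
    ∀ (μ : ℕ → Measure ℝ) [∀ i, IsProbabilityMeasure (μ i)] (y : ℝ),
    walkOp Set.univ n μ (fun _ => c) y = c := by
  induction n with
  | zero => exact fun μ _ y => rfl
  | succ n ih =>
    intro μ _ y
    have : walkOp Set.univ n (fun i => μ (i + 1)) (fun _ => c) = fun _ => c := by
      funext z; exact ih _ z
    rw [walkOp, this]
    simp [stepOp]

theorem monotone_stepOp (hK : IsUpperSet K) (ν : Measure ℝ) (hf : Monotone f) :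
    Monotone (stepOp K ν f) := by
  intro y z hyz
  refine lintegral_mono fun x => ?_
  by_cases hx : y + x ∈ K
  · have hz : z + x ∈ K := hK (by linarith) hx
    simpa [hx, hz] using hf (by linarith)
  · simp [hx]

theorem monotone_walkOp (hK : IsUpperSet K) (hf : Monotone f) (n : ℕ) :
    ∀ μ : ℕ → Measure ℝ, Monotone (walkOp K n μ f) := by
  induction n with
  | zero => exact fun μ => hf
  | succ n ih => exact fun μ => monotone_stepOp hK _ (ih _)

end Walk

/-! ### Association -/

/-- Chebyshev's association inequality: integrate `(f x - f y) (g x - g y) ≥ 0` against `ν ⊗ ν`. The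
cross terms are kept on the left because subtraction in `ℝ≥0∞` is truncated. -/
theorem lintegral_mul_lintegral_le_of_monotone (ν : Measure ℝ) [IsProbabilityMeasure ν]
    {f g : ℝ → ℝ≥0∞} (hf : Monotone f) (hg : Monotone g) :
    (∫⁻ x, f x ∂ν) * (∫⁻ x, g x ∂ν) ≤ ∫⁻ x, f x * g x ∂ν := by
  have mf := hf.measurable
  have mg := hg.measurable
  have key : ∀ x y, f x * g y + f y * g x ≤ f x * g x + f y * g y := by
    have h : ∀ x y, x ≤ y → f x * g y + f y * g x ≤ f x * g x + f y * g y := by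
      intro x y hxy
      obtain ⟨d, hd⟩ := exists_add_of_le (hf hxy)
      rw [hd, add_mul, add_mul]
      calc f x * g y + (f x * g x + d * g x) ≤ f x * g y + (f x * g x + d * g y) := by
            gcongr; exact hg hxy
        _ = _ := by ring
    intro x y
    rcases le_total x y with hxy | hxy
    · exact h x y hxy
    · simpa [add_comm] using h y x hxy
  have e : ∫⁻ x, ∫⁻ y, (f x * g y + f y * g x) ∂ν ∂ν ≤
      ∫⁻ x, ∫⁻ y, (f x * g x + f y * g y) ∂ν ∂ν :=
    lintegral_mono fun x => lintegral_mono fun y => key x y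
  have e1 : ∫⁻ x, ∫⁻ y, (f x * g y + f y * g x) ∂ν ∂ν =
      2 * ((∫⁻ x, f x ∂ν) * (∫⁻ x, g x ∂ν)) := by
    have : ∀ x, ∫⁻ y, (f x * g y + f y * g x) ∂ν =
        f x * (∫⁻ y, g y ∂ν) + (∫⁻ y, f y ∂ν) * g x := fun x => by
      rw [lintegral_add_left (mg.const_mul _), lintegral_const_mul _ mg, lintegral_mul_const _ mf]
    simp_rw [this]
    rw [lintegral_add_left (mf.mul_const _), lintegral_const_mul _ mg, lintegral_mul_const _ mf,
      two_mul]
  have e2 : ∫⁻ x, ∫⁻ y, (f x * g x + f y * g y) ∂ν ∂ν = 2 * ∫⁻ x, f x * g x ∂ν := by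
    have : ∀ x, ∫⁻ y, (f x * g x + f y * g y) ∂ν = f x * g x + ∫⁻ y, f y * g y ∂ν := fun x => by
      rw [lintegral_add_left measurable_const]; simp
    simp_rw [this]
    have hm : Measurable fun x => f x * g x := mf.mul mg
    rw [lintegral_add_left hm, two_mul]; simp
  rw [e1, e2] at e
  exact (ENNReal.mul_le_mul_iff_right (by norm_num) (by norm_num)).1 e

/-- The events `{y + S_n large}` and `{the walk stays in K}` are positively correlated. -/
theorem walkOp_univ_mul_le {K : Set ℝ} (hK : IsUpperSet K) {f : ℝ → ℝ≥0∞} (hf : Monotone f)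
    (n : ℕ) : ∀ (μ : ℕ → Measure ℝ) [∀ i, IsProbabilityMeasure (μ i)] (y : ℝ),
    walkOp Set.univ n μ f y * walkOp K n μ (fun _ => 1) y ≤ walkOp K n μ f y := by
  induction n with
  | zero => exact fun μ _ y => by simp [walkOp]
  | succ n ih =>
    intro μ _ y
    have h1 : Monotone fun x => Set.univ.indicator
        (walkOp Set.univ n (fun i => μ (i + 1)) f) (y + x) := by
      intro a b hab
      simpa using monotone_walkOp isUpperSet_univ hf n _ (by linarith)
    have h2 : Monotone fun x => K.indicator
        (walkOp K n (fun i => μ (i + 1)) fun _ => 1) (y + x) := by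
      intro a b hab
      by_cases ha : y + a ∈ K
      · have hb : y + b ∈ K := hK (by linarith) ha
        simpa [ha, hb] using monotone_walkOp hK monotone_const n _ (by linarith)
      · simp [ha]
    -- As functions of the first increment both factors are increasing, because `K` is an upper set;
    -- after association the induction hypothesis applies pointwise.
    refine (lintegral_mul_lintegral_le_of_monotone (μ 0) h1 h2).trans
      (lintegral_mono fun x => ?_)
    by_cases hx : y + x ∈ K
    · simpa [hx] using ih (fun i => μ (i + 1)) (y + x)
    · simp [hx]

/-! ### One step estimates -/

/-- Jensen's inequality with a gain `h`: integrate the affine minorant plus `h`; the linear term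
vanishes because `ν` is centered. -/
theorem le_stepOp_ofReal {ν : Measure ℝ} [IsProbabilityMeasure ν] (hi : Integrable id ν)
    (h0 : ∫ x, x ∂ν = 0) {z : ℝ} {u : ℝ} {φ : ℝ → ℝ} {c : ℝ} {h : ℝ → ℝ} (hh : Integrable h ν)
    (hle : ∀ x, u + c * x + h x ≤ φ (z + x)) :
    ENNReal.ofReal (u + ∫ x, h x ∂ν) ≤ stepOp Set.univ ν (fun t => ENNReal.ofReal (φ t)) z := by
  have hi' : Integrable (fun x : ℝ => x) ν := hi
  have e : ∫ x, (u + c * x + h x) ∂ν = u + ∫ x, h x ∂ν := by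
    have h1 : Integrable (fun x => u + c * x) ν := (integrable_const u).add (hi'.const_mul c)
    rw [integral_add h1 hh,
      integral_add (integrable_const u) (hi'.const_mul c), integral_const_mul, h0]
    simp
  rw [← e]
  have hint : Integrable (fun x => u + c * x + h x) ν :=
    ((integrable_const u).add (hi'.const_mul c)).add hh
  calc ENNReal.ofReal (∫ x, (u + c * x + h x) ∂ν)
      ≤ ENNReal.ofReal (∫ x, max (u + c * x + h x) 0 ∂ν) :=
        ENNReal.ofReal_le_ofReal (integral_mono hint hint.pos_part fun x => le_max_left _ _)
    _ = ∫⁻ x, ENNReal.ofReal (max (u + c * x + h x) 0) ∂ν :=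
        ofReal_integral_eq_lintegral_ofReal hint.pos_part (ae_of_all _ fun x => le_max_right _ _)
    _ ≤ _ := lintegral_mono fun x => by
        rw [Set.indicator_univ]
        rw [ENNReal.ofReal_max]
        simpa using ENNReal.ofReal_le_ofReal (hle x)

/-- Killing below `0` costs nothing here, since the positive part already vanishes there. -/
theorem le_stepOp_ofReal_id {ν : Measure ℝ} [IsProbabilityMeasure ν] (hi : Integrable id ν)
    (h0 : ∫ x, x ∂ν = 0) (z : ℝ) :
    ENNReal.ofReal z ≤ stepOp (Set.Ici 0) ν ENNReal.ofReal z := by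
  have := le_stepOp_ofReal hi h0 (z := z) (u := z) (φ := fun t => t) (c := 1) (h := fun _ => 0)
    (integrable_zero _ _ _) (fun x => by linarith)
  simp only [integral_zero, add_zero] at this
  refine this.trans (lintegral_mono fun x => ?_)
  by_cases hx : 0 ≤ z + x
  · simp [hx]
  · simp [ENNReal.ofReal_of_nonpos (not_le.1 hx).le]

/-- Without killing, `z + b + X` has mean `z + b`. Adding `b^{-(1+δ)} |x|^{2+δ}` makes the integrand
nonnegative everywhere, since `|x| > b` implies `|x| ≤ b^{-(1+δ)} |x|^{2+δ}`; the indicator can then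
be dropped. The shift `b` ensures that only jumps larger than `b` are paid for. -/
theorem stepOp_ofReal_add_le {ν : Measure ℝ} [IsProbabilityMeasure ν] (hi : Integrable id ν)
    (h0 : ∫ x, x ∂ν = 0) {b δ : ℝ} (hb : 0 < b) (hδ : 0 < δ) {z : ℝ} (hz : 0 ≤ z) :
    stepOp (Set.Ici 0) ν (fun t => ENNReal.ofReal (t + b)) z ≤
      ENNReal.ofReal (z + b) +
        ENNReal.ofReal (b ^ (1 + δ))⁻¹ * ∫⁻ x, ENNReal.ofReal (|x| ^ (2 + δ)) ∂ν := by
  have hb' : 0 < b ^ (1 + δ) := Real.rpow_pos_of_pos hb _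
  by_cases hm : ∫⁻ x, ENNReal.ofReal (|x| ^ (2 + δ)) ∂ν = ∞
  · rw [hm, ENNReal.mul_top (by simpa using hb')]
    simp
  have hmeas : Measurable fun x : ℝ => |x| ^ (2 + δ) := by fun_prop
  have hI : Integrable (fun x : ℝ => |x| ^ (2 + δ)) ν := by
    refine ⟨hmeas.aestronglyMeasurable, ?_⟩
    rw [hasFiniteIntegral_iff_ofReal (ae_of_all _ fun x => by positivity)]
    exact lt_top_iff_ne_top.2 hm
  have hi' : Integrable (fun x : ℝ => x) ν := hi
  have hpt : ∀ x : ℝ, ENNReal.ofReal (z + x + b) ≤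
      ENNReal.ofReal (z + b + x + (b ^ (1 + δ))⁻¹ * |x| ^ (2 + δ)) := by
    intro x
    have hnn : 0 ≤ (b ^ (1 + δ))⁻¹ * |x| ^ (2 + δ) := by positivity
    exact ENNReal.ofReal_le_ofReal (by linarith)
  have hnn : ∀ x : ℝ, 0 ≤ z + b + x + (b ^ (1 + δ))⁻¹ * |x| ^ (2 + δ) := by
    intro x
    have h2 : 0 ≤ (b ^ (1 + δ))⁻¹ * |x| ^ (2 + δ) := by positivity
    rcases le_or_gt |x| b with hx | hx
    · have := neg_abs_le x
      linarith
    · have hx0 : 0 < |x| := hb.trans hx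
      have e : |x| ^ (2 + δ) = |x| * |x| ^ (1 + δ) := by
        rw [show 2 + δ = 1 + (1 + δ) by ring, Real.rpow_add hx0, Real.rpow_one]
      have h3 : b ^ (1 + δ) ≤ |x| ^ (1 + δ) := Real.rpow_le_rpow hb.le hx.le (by linarith)
      have h4 : |x| ≤ (b ^ (1 + δ))⁻¹ * |x| ^ (2 + δ) := by
        rw [e, inv_mul_eq_div, le_div_iff₀ hb']
        exact mul_le_mul_of_nonneg_left h3 hx0.le
      have := neg_abs_le x
      linarith
  have hint1 : Integrable (fun x => z + b + x) ν := (integrable_const _).add hi'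
  have hint : Integrable (fun x => z + b + x + (b ^ (1 + δ))⁻¹ * |x| ^ (2 + δ)) ν :=
    hint1.add (hI.const_mul _)
  calc stepOp (Set.Ici 0) ν (fun t => ENNReal.ofReal (t + b)) z
      ≤ ∫⁻ x, ENNReal.ofReal (z + b + x + (b ^ (1 + δ))⁻¹ * |x| ^ (2 + δ)) ∂ν :=
        lintegral_mono fun x => (Set.indicator_le_self _ _ _).trans (hpt x)
    _ = ENNReal.ofReal (∫ x, (z + b + x + (b ^ (1 + δ))⁻¹ * |x| ^ (2 + δ)) ∂ν) :=
        (ofReal_integral_eq_lintegral_ofReal hint (ae_of_all _ hnn)).symm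
    _ = ENNReal.ofReal (z + b + (b ^ (1 + δ))⁻¹ * ∫ x, |x| ^ (2 + δ) ∂ν) := by
        rw [integral_add hint1 (hI.const_mul _), integral_add (integrable_const _) hi',
          integral_const_mul, h0]
        simp
    _ = _ := by
        rw [ENNReal.ofReal_add (by positivity)
          (mul_nonneg (by positivity) (integral_nonneg fun x => by positivity)),
          ENNReal.ofReal_mul (by positivity),
          ofReal_integral_eq_lintegral_ofReal hI (ae_of_all _ fun x => by positivity)]

/-! ### The free walk: `E[S_n⁺]` grows at least like `√n` -/

/-- A smooth convex approximation of the absolute value. -/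
def softAbs (l z : ℝ) : ℝ := √(l ^ 2 + z ^ 2)

theorem softAbs_le {l : ℝ} (hl : 0 ≤ l) (z : ℝ) : softAbs l z ≤ l + |z| := by
  refine Real.sqrt_le_iff.2 ⟨by positivity, ?_⟩
  nlinarith [sq_abs z, abs_nonneg z, mul_nonneg hl (abs_nonneg z)]

/-- Let `p`, `q` be the values at `z` and `z + x`, and `r` the inner product of `(l, z)` and `(l, z
+ x)`. The excess over the tangent line is `(p q - r) / p`, and Lagrange's identity `(p q - r) (p q
+ r) = l² x²` with `r ≤ p q` bounds it below by `l² x² / (2 p² q)`. -/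
theorem softAbs_add_ge {l : ℝ} (hl : 1 ≤ l) (z x : ℝ) :
    softAbs l z + z / softAbs l z * x + (if |z| ≤ l then min (x ^ 2) 1 / (12 * l) else 0) ≤
      softAbs l (z + x) := by
  have hp2 : softAbs l z ^ 2 = l ^ 2 + z ^ 2 := Real.sq_sqrt (by positivity)
  have hq2 : softAbs l (z + x) ^ 2 = l ^ 2 + (z + x) ^ 2 := Real.sq_sqrt (by positivity)
  have hp0 : 0 < softAbs l z := Real.sqrt_pos.2 (by positivity)
  have hq0 : 0 < softAbs l (z + x) := Real.sqrt_pos.2 (by positivity)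
  generalize softAbs l z = p at *
  generalize softAbs l (z + x) = q at *
  set r := l ^ 2 + z * (z + x) with hr
  have hprod : (p * q - r) * (p * q + r) = l ^ 2 * x ^ 2 := by
    have : (p * q - r) * (p * q + r) = p ^ 2 * q ^ 2 - r ^ 2 := by ring
    rw [this, hp2, hq2, hr]
    ring
  have hrle : r ≤ p * q := by
    refine abs_le_of_sq_le_sq' ?_ (by positivity) |>.2
    nlinarith [sq_nonneg (l * x)]
  have hgain : q - p - z / p * x = (p * q - r) / p := by
    field_simp
    rw [hr]
    nlinarith
  split_ifs with hz
  · have h1 : l ^ 2 * x ^ 2 / (2 * (p * q)) ≤ p * q - r := by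
      rw [div_le_iff₀ (by positivity), ← hprod]
      exact mul_le_mul_of_nonneg_left (by linarith) (by linarith)
    have hq : q ≤ 2 * l + |x| := by
      refine abs_le_of_sq_le_sq' ?_ (by positivity) |>.2
      have h3 : |z + x| ≤ l + |x| := (abs_add_le z x).trans (by linarith)
      have h4 : (z + x) ^ 2 ≤ (l + |x|) ^ 2 := by
        rw [← sq_abs (z + x)]
        exact pow_le_pow_left₀ (abs_nonneg _) h3 2
      rw [hq2]
      nlinarith [abs_nonneg x, mul_nonneg (by linarith : (0 : ℝ) ≤ l) (abs_nonneg x)]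
    have hp : p ^ 2 ≤ 2 * l ^ 2 := by
      have : z ^ 2 ≤ l ^ 2 := sq_le_sq' (by linarith [neg_abs_le z]) ((le_abs_self z).trans hz)
      linarith
    -- For `|z| ≤ l`, the bounds `p² ≤ 2 l²` and `q ≤ 2 l + |x|` give an excess of at least `x² / (4
    -- (2 l + |x|))`. The `12` is `4 · 3`: use `|x| ≤ l` if `|x| ≤ 1`, and `|x| ≤ x²` otherwise.
    have h5 : min (x ^ 2) 1 / (12 * l) ≤ (p * q - r) / p := by
      have h6 : x ^ 2 / (4 * (2 * l + |x|)) ≤ (p * q - r) / p := by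
        calc x ^ 2 / (4 * (2 * l + |x|)) ≤ x ^ 2 / (4 * q) := by gcongr
          _ = l ^ 2 * x ^ 2 / (2 * (2 * l ^ 2) * q) := by field_simp; ring
          _ ≤ l ^ 2 * x ^ 2 / (2 * p ^ 2 * q) := by gcongr
          _ = l ^ 2 * x ^ 2 / (2 * (p * q)) / p := by field_simp
          _ ≤ _ := by gcongr
      refine le_trans ?_ h6
      rw [div_le_div_iff₀ (by positivity) (by positivity)]
      rcases le_total |x| 1 with hx | hx
      · have hx' : min (x ^ 2) 1 ≤ x ^ 2 := min_le_left _ _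
        calc min (x ^ 2) 1 * (4 * (2 * l + |x|)) ≤ x ^ 2 * (4 * (2 * l + l)) := by
              gcongr; linarith
          _ = _ := by ring
      · have hx' : min (x ^ 2) 1 ≤ 1 := min_le_right _ _
        have hx2 : |x| ≤ x ^ 2 := by rw [← sq_abs]; nlinarith
        calc min (x ^ 2) 1 * (4 * (2 * l + |x|)) ≤ 1 * (4 * (2 * l + |x|)) := by gcongr
          _ ≤ x ^ 2 * (12 * l) := by nlinarith
    linarith
  · have : 0 ≤ (p * q - r) / p := div_nonneg (by linarith) hp0.le
    linarith

/-- `E[X² ∧ 1]` for a random variable of law `ν`. -/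
def truncVar (ν : Measure ℝ) : ℝ := ∫ x, min (x ^ 2) 1 ∂ν

theorem integrable_min_sq (ν : Measure ℝ) [IsFiniteMeasure ν] :
    Integrable (fun x : ℝ => min (x ^ 2) 1) ν :=
  Integrable.of_bound (by fun_prop) 1 (ae_of_all _ fun x => by
    rw [Real.norm_of_nonneg (by positivity)]
    exact min_le_right _ _)

theorem truncVar_nonneg (ν : Measure ℝ) : 0 ≤ truncVar ν :=
  integral_nonneg fun x => by positivity

theorem stepOp_softAbs_ge {ν : Measure ℝ} [IsProbabilityMeasure ν] (hi : Integrable id ν)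
    (h0 : ∫ x, x ∂ν = 0) {l : ℝ} (hl : 1 ≤ l) (z : ℝ) :
    ENNReal.ofReal (softAbs l z) +
        ENNReal.ofReal (truncVar ν / (12 * l)) * (Set.Icc (-l) l).indicator (fun _ => 1) z ≤
      stepOp Set.univ ν (fun t => ENNReal.ofReal (softAbs l t)) z := by
  have hnn : 0 ≤ softAbs l z := Real.sqrt_nonneg _
  refine le_trans (le_of_eq ?_) (le_stepOp_ofReal hi h0 (z := z) (u := softAbs l z)
    (φ := softAbs l) (c := z / softAbs l z)
    (h := fun x => if |z| ≤ l then min (x ^ 2) 1 / (12 * l) else 0) ?_ (softAbs_add_ge hl z))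
  · by_cases hz : |z| ≤ l
    · have hz' : z ∈ Set.Icc (-l) l := abs_le.1 hz
      simp only [hz, if_true, hz', Set.indicator_of_mem, mul_one]
      rw [integral_div, ← truncVar, ENNReal.ofReal_add hnn]
      exact div_nonneg (truncVar_nonneg ν) (by linarith)
    · have hz' : z ∉ Set.Icc (-l) l := fun h => hz (abs_le.2 h)
      simp [hz, hz']
  · split_ifs
    · exact (integrable_min_sq ν).div_const _
    · exact integrable_zero _ _ _

/-- This is `E[z + X] = z`, with positive and negative parts separated so that it can be iterated in
`ℝ≥0∞`. -/
theorem stepOp_univ_ofReal_add {ν : Measure ℝ} [IsProbabilityMeasure ν] (hi : Integrable id ν)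
    (h0 : ∫ x, x ∂ν = 0) (z : ℝ) :
    stepOp Set.univ ν ENNReal.ofReal z + ENNReal.ofReal (-z) =
      stepOp Set.univ ν (fun t => ENNReal.ofReal (-t)) z + ENNReal.ofReal z := by
  have hi' : Integrable (fun x : ℝ => x) ν := hi
  have hI : Integrable (fun x => z + x) ν := (integrable_const z).add hi'
  have h := integral_eq_lintegral_pos_part_sub_lintegral_neg_part hI
  rw [integral_add (integrable_const z) hi', h0] at h
  have f1 : ∫⁻ x, ENNReal.ofReal (z + x) ∂ν ≠ ∞ := hI.lintegral_lt_top.ne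
  have f2 : ∫⁻ x, ENNReal.ofReal (-(z + x)) ∂ν ≠ ∞ := hI.neg.lintegral_lt_top.ne
  simp only [stepOp, Set.indicator_univ]
  rw [← ENNReal.toReal_eq_toReal_iff' (by simp [f1])
    (ENNReal.add_ne_top.2 ⟨f2, ENNReal.ofReal_ne_top⟩), ENNReal.toReal_add f1 (by simp),
    ENNReal.toReal_add f2 (by simp)]
  have e : (ENNReal.ofReal z).toReal - (ENNReal.ofReal (-z)).toReal = z := by
    rw [ENNReal.toReal_ofReal', ENNReal.toReal_ofReal']
    rcases le_total 0 z with hz | hz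
    · rw [max_eq_left hz, max_eq_right (by linarith)]; ring
    · rw [max_eq_right hz, max_eq_left (by linarith)]; ring
  simp only [integral_const, probReal_univ, smul_eq_mul, one_mul, add_zero] at h
  linarith

section Free

variable {μ : ℕ → Measure ℝ} [∀ i, IsProbabilityMeasure (μ i)]
  (hi : ∀ i, Integrable id (μ i)) (h0 : ∀ i, ∫ x, x ∂μ i = 0)

theorem ofReal_abs_eq (z : ℝ) :
    ENNReal.ofReal |z| = ENNReal.ofReal z + ENNReal.ofReal (-z) := by
  rcases le_total 0 z with hz | hz
  · rw [abs_of_nonneg hz, ENNReal.ofReal_of_nonpos (by linarith : -z ≤ 0), add_zero]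
  · rw [abs_of_nonpos hz, ENNReal.ofReal_of_nonpos hz, zero_add]

theorem measurable_ofReal_neg : Measurable fun t : ℝ => ENNReal.ofReal (-t) := by fun_prop

include hi in
theorem walkOp_univ_abs_ne_top (n : ℕ) :
    walkOp Set.univ n μ (fun t => ENNReal.ofReal |t|) 0 ≠ ∞ := by
  induction n with
  | zero => simp [walkOp]
  | succ n ih =>
    rw [walkOp_succ]
    have hle : ∀ z ∈ Set.univ, stepOp Set.univ (μ n) (fun t => ENNReal.ofReal |t|) z ≤
        ENNReal.ofReal |z| + ∫⁻ x, ENNReal.ofReal |x| ∂μ n := by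
      intro z _
      calc stepOp Set.univ (μ n) (fun t => ENNReal.ofReal |t|) z
          ≤ ∫⁻ x, (ENNReal.ofReal |z| + ENNReal.ofReal |x|) ∂μ n := by
            refine lintegral_mono fun x => ?_
            rw [Set.indicator_univ, ← ENNReal.ofReal_add (abs_nonneg _) (abs_nonneg _)]
            exact ENNReal.ofReal_le_ofReal (abs_add_le _ _)
        _ = _ := by rw [lintegral_add_left measurable_const]; simp
    refine ne_top_of_le_ne_top ?_ (walkOp_mono hle n μ 0 trivial)
    rw [walkOp_add MeasurableSet.univ (by fun_prop)]
    simp only [walkOp_univ_const]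
    exact ENNReal.add_ne_top.2 ⟨ih, (hi n).abs.lintegral_lt_top.ne⟩

include hi h0 in
theorem walkOp_univ_ofReal_neg (n : ℕ) :
    walkOp Set.univ n μ (fun t => ENNReal.ofReal (-t)) 0 =
      walkOp Set.univ n μ ENNReal.ofReal 0 := by
  induction n with
  | zero => simp [walkOp]
  | succ n ih =>
    have e := congrArg (fun f => walkOp Set.univ n μ f 0)
      (funext (stepOp_univ_ofReal_add (hi n) (h0 n)))
    have m1 := measurable_stepOp MeasurableSet.univ (μ n) ENNReal.measurable_ofReal
    have m2 := measurable_stepOp MeasurableSet.univ (μ n) measurable_ofReal_neg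
    rw [walkOp_add MeasurableSet.univ m1, walkOp_add MeasurableSet.univ m2] at e
    beta_reduce at e
    rw [← walkOp_succ, ← walkOp_succ, ih] at e
    refine ((ENNReal.add_left_inj ?_).1 e).symm
    exact ne_top_of_le_ne_top (walkOp_univ_abs_ne_top hi n)
      (walkOp_mono (fun z _ => ENNReal.ofReal_le_ofReal (le_abs_self z)) n μ 0 trivial)

include hi h0 in
theorem walkOp_univ_abs (n : ℕ) :
    walkOp Set.univ n μ (fun t => ENNReal.ofReal |t|) 0 =
      2 * walkOp Set.univ n μ ENNReal.ofReal 0 := by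
  simp_rw [ofReal_abs_eq]
  rw [walkOp_add MeasurableSet.univ ENNReal.measurable_ofReal]
  simp only
  rw [walkOp_univ_ofReal_neg hi h0, two_mul]

include hi h0 in
theorem monotone_walkOp_univ_ofReal : Monotone fun n => walkOp Set.univ n μ ENNReal.ofReal 0 := by
  refine monotone_nat_of_le_succ fun n => ?_
  rw [walkOp_succ]
  refine walkOp_mono (fun z _ => (le_stepOp_ofReal_id (hi n) (h0 n) z).trans ?_) n μ 0 trivial
  exact lintegral_mono fun x =>
    Set.indicator_le_indicator_of_subset (Set.subset_univ _) (fun _ => bot_le) _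

include hi h0 in
-- Markov's inequality for `|S_k|`, whose mean is `2 E[S_k⁺]`.
theorem walkOp_univ_Icc_ge (k : ℕ) {l : ℝ} (hl : 0 < l) :
    1 ≤ walkOp Set.univ k μ ((Set.Icc (-l) l).indicator fun _ => 1) 0 +
      ENNReal.ofReal l⁻¹ * (2 * walkOp Set.univ k μ ENNReal.ofReal 0) := by
  have hm : Measurable ((Set.Icc (-l) l).indicator fun _ => (1 : ℝ≥0∞)) :=
    measurable_const.indicator measurableSet_Icc
  rw [← walkOp_univ_abs hi h0]
  have e := congrFun (walkOp_const_mul (K := Set.univ) MeasurableSet.univ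
    (f := fun t => ENNReal.ofReal |t|) (by fun_prop) (ENNReal.ofReal l⁻¹) k μ) 0
  have e' := congrFun (walkOp_add (K := Set.univ) MeasurableSet.univ hm
    (fun t => ENNReal.ofReal l⁻¹ * ENNReal.ofReal |t|) k μ) 0
  rw [← e, ← e']
  refine (walkOp_univ_const k 1 μ 0).ge.trans (walkOp_mono (fun z _ => ?_) k μ 0 trivial)
  by_cases hz : z ∈ Set.Icc (-l) l
  · simp [hz]
  · have hz' : l < |z| := not_le.1 fun h => hz (abs_le.1 h)
    rw [Set.indicator_of_notMem hz, zero_add, ← ENNReal.ofReal_mul (by positivity),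
      ENNReal.one_le_ofReal, inv_mul_eq_div, one_le_div hl]
    exact hz'.le

include hi h0 in
-- The compensator of the submartingale `√(l² + S_n²)`: step `k` contributes its gain whenever
-- `|S_k| ≤ l`.
theorem walkOp_univ_softAbs_ge {l : ℝ} (hl : 1 ≤ l) (n : ℕ) :
    ENNReal.ofReal l + ∑ k ∈ Finset.range n, ENNReal.ofReal (truncVar (μ k) / (12 * l)) *
        walkOp Set.univ k μ ((Set.Icc (-l) l).indicator fun _ => 1) 0 ≤
      walkOp Set.univ n μ (fun t => ENNReal.ofReal (softAbs l t)) 0 := by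
  have hm : Measurable ((Set.Icc (-l) l).indicator fun _ => (1 : ℝ≥0∞)) :=
    measurable_const.indicator measurableSet_Icc
  induction n with
  | zero => simp [walkOp, softAbs, Real.sqrt_sq (by linarith : 0 ≤ l)]
  | succ n ih =>
    rw [Finset.sum_range_succ, ← add_assoc, walkOp_succ]
    refine le_trans ?_ (walkOp_mono
      (fun z _ => stepOp_softAbs_ge (hi n) (h0 n) hl z) n μ 0 trivial)
    have hs : Measurable fun z => ENNReal.ofReal (softAbs l z) := by
      unfold softAbs; fun_prop
    rw [walkOp_add MeasurableSet.univ hs, walkOp_const_mul MeasurableSet.univ hm]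
    exact add_le_add_left ih _

include hi h0 in
/-- `E[S_n⁺] ≥ c √n` as soon as `∑_{i < n} E[X_i² ∧ 1]` grows linearly. -/
theorem walkOp_univ_ofReal_ge {c : ℝ} (hc : 0 < c) {n : ℕ} (hn : 1 ≤ n)
    (hsum : c * n ≤ ∑ i ∈ Finset.range n, truncVar (μ i)) :
    ENNReal.ofReal (min (c / 48) (1 / 4) * √n) ≤ walkOp Set.univ n μ ENNReal.ofReal 0 := by
  set e := walkOp Set.univ n μ ENNReal.ofReal 0 with he
  set l := √(n : ℝ) with hl_def
  have hl : 1 ≤ l := Real.one_le_sqrt.2 (by exact_mod_cast hn)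
  have hl2 : l * l = n := Real.mul_self_sqrt (by positivity)
  have hfin : e ≠ ∞ := ne_top_of_le_ne_top (walkOp_univ_abs_ne_top hi n)
    (walkOp_mono (fun z _ => ENNReal.ofReal_le_ofReal (le_abs_self z)) n μ 0 trivial)
  obtain ⟨r, hr0, hr⟩ : ∃ r : ℝ, 0 ≤ r ∧ e = ENNReal.ofReal r :=
    ⟨e.toReal, ENNReal.toReal_nonneg, (ENNReal.ofReal_toReal hfin).symm⟩
  rw [hr]
  refine ENNReal.ofReal_le_ofReal ?_
  -- Take `l = √n` and suppose `r = E[S_n⁺]` is too small. As `E[S_k⁺] ≤ r < l / 4` for `k ≤ n`,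
  -- Markov's inequality gives `P(|S_k| ≤ l) ≥ 1/2`, and the compensator yields `l + c n / (24 l) ≤
  -- E[√(l² + S_n²)] ≤ l + 2 r`. Hence `r ≥ c l / 48`, a contradiction.
  by_contra! hlt
  have hr1 : r < c / 48 * l := hlt.trans_le (by gcongr; exact min_le_left _ _)
  have hr2 : r < 1 / 4 * l := hlt.trans_le (by gcongr; exact min_le_right _ _)
  have hhalf : ∀ k ∈ Finset.range n, ENNReal.ofReal (1 / 2) ≤
      walkOp Set.univ k μ ((Set.Icc (-l) l).indicator fun _ => 1) 0 := by
    intro k hk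
    have h1 := walkOp_univ_Icc_ge hi h0 k (l := l) (by linarith)
    have h2 : ENNReal.ofReal l⁻¹ * (2 * walkOp Set.univ k μ ENNReal.ofReal 0) ≤
        ENNReal.ofReal (1 / 2) := by
      calc _ ≤ ENNReal.ofReal l⁻¹ * (2 * e) := by
            gcongr
            exact monotone_walkOp_univ_ofReal hi h0 (Finset.mem_range.1 hk).le
        _ = ENNReal.ofReal (l⁻¹ * (2 * r)) := by
            rw [hr, ENNReal.ofReal_mul (by positivity), ENNReal.ofReal_mul (by norm_num)]
            simp
        _ ≤ _ := by
            refine ENNReal.ofReal_le_ofReal ?_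
            rw [inv_mul_eq_div, div_le_iff₀ (by linarith)]
            linarith
    have h3 : ENNReal.ofReal (1 / 2) + ENNReal.ofReal (1 / 2) = 1 := by
      rw [← ENNReal.ofReal_add (by norm_num) (by norm_num)]; norm_num
    exact ENNReal.le_of_add_le_add_right ENNReal.ofReal_ne_top
      (h3.le.trans (h1.trans (add_le_add_right h2 _)))
  have hlow := walkOp_univ_softAbs_ge hi h0 hl n
  have hup : walkOp Set.univ n μ (fun t => ENNReal.ofReal (softAbs l t)) 0 ≤
      ENNReal.ofReal (l + 2 * r) := by
    calc _ ≤ walkOp Set.univ n μ (fun t => ENNReal.ofReal |t| + ENNReal.ofReal l) 0 := by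
          refine walkOp_mono (fun z _ => ?_) n μ 0 trivial
          rw [← ENNReal.ofReal_add (abs_nonneg _) (by linarith)]
          refine ENNReal.ofReal_le_ofReal ?_
          rw [add_comm]
          exact softAbs_le (by linarith) z
      _ = 2 * e + ENNReal.ofReal l := by
          rw [walkOp_add MeasurableSet.univ (by fun_prop)]
          simp only [walkOp_univ_const]
          rw [walkOp_univ_abs hi h0]
      _ = _ := by
          rw [hr, add_comm, ENNReal.ofReal_add (by linarith) (by linarith),
            ENNReal.ofReal_mul (by norm_num)]
          simp
  have hs : ENNReal.ofReal (l + c * n / (24 * l)) ≤ ENNReal.ofReal (l + 2 * r) := by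
    refine le_trans ?_ (hlow.trans hup)
    rw [ENNReal.ofReal_add (by linarith) (by positivity)]
    refine add_le_add_right ?_ _
    have h24 : ∀ k, 0 ≤ truncVar (μ k) / (24 * l) := fun k =>
      div_nonneg (truncVar_nonneg _) (by linarith)
    calc ENNReal.ofReal (c * n / (24 * l))
        ≤ ENNReal.ofReal (∑ k ∈ Finset.range n, truncVar (μ k) / (24 * l)) := by
          rw [← Finset.sum_div]
          exact ENNReal.ofReal_le_ofReal (by gcongr)
      _ = ∑ k ∈ Finset.range n, ENNReal.ofReal (truncVar (μ k) / (12 * l)) *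
            ENNReal.ofReal (1 / 2) := by
          rw [ENNReal.ofReal_sum_of_nonneg fun k _ => h24 k]
          refine Finset.sum_congr rfl fun k _ => ?_
          rw [← ENNReal.ofReal_mul (div_nonneg (truncVar_nonneg _) (by linarith))]
          congr 1
          field_simp
          ring
      _ ≤ _ := Finset.sum_le_sum fun k hk => by gcongr; exact hhalf k hk
  rw [ENNReal.ofReal_le_ofReal_iff (by linarith)] at hs
  have : c * n / (24 * l) = c / 24 * l := by
    rw [← hl2]; field_simp
  linarith

end Free

/-! ### The killed walk: `E[y + S_n; τ_y > n]` is bounded in `n` -/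

/-- A discrete Grönwall inequality. -/
theorem exists_bound_of_le_mul_one_add {W a : ℕ → ℝ≥0∞} (ha : ∑' n, a n ≠ ∞) {N : ℕ}
    (hN : W N ≠ ∞) (h : ∀ n, N ≤ n → W (n + 1) ≤ W n * (1 + a n)) :
    ∃ C, C ≠ ∞ ∧ ∀ n, N ≤ n → W n ≤ C := by
  have hfin : ∀ n, a n ≠ ∞ := ENNReal.ne_top_of_tsum_ne_top ha
  have hsum : Summable fun n => (a n).toReal := ENNReal.summable_toReal ha
  have key : ∀ n, N ≤ n →
      W n ≤ W N * ENNReal.ofReal (Real.exp (∑ i ∈ Finset.range n, (a i).toReal)) := by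
    intro n hn
    induction n, hn using Nat.le_induction with
    | base =>
      refine le_mul_of_one_le_right' ?_
      rw [ENNReal.one_le_ofReal]
      exact Real.one_le_exp (Finset.sum_nonneg fun i _ => ENNReal.toReal_nonneg)
    | succ n hn ih =>
      refine (h n hn).trans ?_
      rw [Finset.sum_range_succ, Real.exp_add, ENNReal.ofReal_mul (Real.exp_nonneg _), ← mul_assoc]
      refine mul_le_mul' ih ?_
      rw [← ENNReal.ofReal_toReal (hfin n), ← ENNReal.ofReal_one,
        ← ENNReal.ofReal_add zero_le_one ENNReal.toReal_nonneg,
        ENNReal.toReal_ofReal ENNReal.toReal_nonneg]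
      refine ENNReal.ofReal_le_ofReal ?_
      rw [add_comm]
      exact Real.add_one_le_exp _
  refine ⟨W N * ENNReal.ofReal (Real.exp (∑' i, (a i).toReal)),
    ENNReal.mul_ne_top hN ENNReal.ofReal_ne_top, fun n hn => (key n hn).trans ?_⟩
  gcongr
  exact hsum.sum_le_tsum _ fun i _ => ENNReal.toReal_nonneg

section Killed

variable {μ : ℕ → Measure ℝ} [∀ i, IsProbabilityMeasure (μ i)]
  (hi : ∀ i, Integrable id (μ i)) (h0 : ∀ i, ∫ x, x ∂μ i = 0)

include hi h0 in
theorem monotone_walkOp_Ici_ofReal {y : ℝ} (hy : 0 ≤ y) :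
    Monotone fun n => walkOp (Set.Ici 0) n μ ENNReal.ofReal y := by
  refine monotone_nat_of_le_succ fun n => ?_
  rw [walkOp_succ]
  exact walkOp_mono (fun z _ => le_stepOp_ofReal_id (hi n) (h0 n) z) n μ y hy

include hi in
theorem walkOp_Ici_ofReal_add_ne_top (n : ℕ) {y : ℝ} (hy : 0 ≤ y) :
    ∀ b : ℝ, walkOp (Set.Ici 0) n μ (fun t => ENNReal.ofReal (t + b)) y ≠ ∞ := by
  induction n with
  | zero => intro b; simp [walkOp]
  | succ n ih =>
    intro b
    rw [walkOp_succ]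
    have hle : ∀ z ∈ Set.Ici (0 : ℝ),
        stepOp (Set.Ici 0) (μ n) (fun t => ENNReal.ofReal (t + b)) z ≤
        ENNReal.ofReal (z + |b|) + (∫⁻ x, ENNReal.ofReal |x| ∂μ n) * 1 := by
      intro z hz
      calc stepOp (Set.Ici 0) (μ n) (fun t => ENNReal.ofReal (t + b)) z
          ≤ ∫⁻ x, (ENNReal.ofReal (z + |b|) + ENNReal.ofReal |x|) ∂μ n := by
            refine lintegral_mono fun x => (Set.indicator_le_self _ _ _).trans ?_
            have hz' : 0 ≤ z := hz
            rw [← ENNReal.ofReal_add (by positivity) (abs_nonneg _)]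
            exact ENNReal.ofReal_le_ofReal (by linarith [le_abs_self x, le_abs_self b])
        _ = _ := by rw [lintegral_add_left measurable_const]; simp
    refine ne_top_of_le_ne_top ?_ (walkOp_mono hle n μ y hy)
    rw [walkOp_add measurableSet_Ici (by fun_prop), walkOp_const_mul measurableSet_Ici (by fun_prop)]
    refine ENNReal.add_ne_top.2 ⟨ih _, ENNReal.mul_ne_top (hi n).abs.lintegral_lt_top.ne ?_⟩
    exact ne_top_of_le_ne_top ENNReal.one_ne_top (walkOp_one_le n μ y)

include hi h0 in
/-- The recursion on which the Grönwall argument is based. -/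
theorem walkOp_Ici_succ_le {δ : ℝ} (hδ : 0 < δ) {y : ℝ} (hy : 0 ≤ y) {n : ℕ} {b b' k : ℝ}
    (hb' : 0 < b') (hbb' : b ≤ b') (hb : 0 ≤ b) (hk : 0 < k)
    (hE : ENNReal.ofReal k ≤ walkOp Set.univ n μ ENNReal.ofReal 0) :
    walkOp (Set.Ici 0) (n + 1) μ (fun t => ENNReal.ofReal (t + b')) y ≤
      walkOp (Set.Ici 0) n μ (fun t => ENNReal.ofReal (t + b)) y *
        (1 + ENNReal.ofReal k⁻¹ * (ENNReal.ofReal (b' - b) +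
          ENNReal.ofReal (b' ^ (1 + δ))⁻¹ * ∫⁻ x, ENNReal.ofReal (|x| ^ (2 + δ)) ∂μ n)) := by
  set r := ENNReal.ofReal (b' - b) +
    ENNReal.ofReal (b' ^ (1 + δ))⁻¹ * ∫⁻ x, ENNReal.ofReal (|x| ^ (2 + δ)) ∂μ n with hr
  set W := walkOp (Set.Ici 0) n μ (fun t => ENNReal.ofReal (t + b)) y with hW
  have hle : ∀ z ∈ Set.Ici (0 : ℝ),
      stepOp (Set.Ici 0) (μ n) (fun t => ENNReal.ofReal (t + b')) z ≤
        ENNReal.ofReal (z + b) + r * 1 := by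
    intro z hz
    refine (stepOp_ofReal_add_le (hi n) (h0 n) hb' hδ hz).trans (le_of_eq ?_)
    have hz' : 0 ≤ z := hz
    rw [mul_one, hr, ← add_assoc, ← ENNReal.ofReal_add (by linarith) (by linarith)]
    congr 2
    ring
  have h1 : walkOp (Set.Ici 0) (n + 1) μ (fun t => ENNReal.ofReal (t + b')) y ≤
      W + r * walkOp (Set.Ici 0) n μ (fun _ => 1) y := by
    rw [walkOp_succ]
    refine (walkOp_mono hle n μ y hy).trans (le_of_eq ?_)
    rw [walkOp_add measurableSet_Ici (by fun_prop), walkOp_const_mul measurableSet_Ici (by fun_prop)]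
  have hofReal : Monotone ENNReal.ofReal := fun a b => ENNReal.ofReal_le_ofReal
  -- Association turns the lower bound on the free walk into a bound on the survival probability in
  -- terms of `W` itself, which makes the recursion multiplicative.
  have h2 : ENNReal.ofReal k * walkOp (Set.Ici 0) n μ (fun _ => 1) y ≤ W :=
    calc _ ≤ walkOp Set.univ n μ ENNReal.ofReal y * walkOp (Set.Ici 0) n μ (fun _ => 1) y := by
          gcongr
          exact hE.trans (monotone_walkOp isUpperSet_univ hofReal n μ hy)
      _ ≤ walkOp (Set.Ici 0) n μ ENNReal.ofReal y :=
          walkOp_univ_mul_le (isUpperSet_Ici 0) hofReal n μ y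
      _ ≤ W := walkOp_mono (fun z _ => ENNReal.ofReal_le_ofReal (by linarith)) n μ y hy
  have h3 : walkOp (Set.Ici 0) n μ (fun _ => 1) y ≤ W * ENNReal.ofReal k⁻¹ := by
    rw [ENNReal.ofReal_inv_of_pos hk, ← div_eq_mul_inv,
      ENNReal.le_div_iff_mul_le (Or.inl (by simpa using hk)) (Or.inl ENNReal.ofReal_ne_top),
      mul_comm]
    exact h2
  calc _ ≤ W + r * (W * ENNReal.ofReal k⁻¹) := h1.trans (by gcongr)
    _ = _ := by ring

include hi h0 in
-- Grönwall's inequality for the killed walk shifted by the slowly growing barrier `n ^ p`; the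
-- barrier is dropped at the end.
theorem exists_bound_walkOp_Ici {δ c : ℝ} (hδ : 0 < δ) (hc : 0 < c)
    (hm : ∑' n : ℕ, ENNReal.ofReal (((n : ℝ) + 1) ^ (-(1 + δ / 4))) *
      ∫⁻ x, ENNReal.ofReal (|x| ^ (2 + δ)) ∂μ n ≠ ∞)
    (hv : ∀ᶠ n : ℕ in atTop, c * n ≤ ∑ i ∈ Finset.range n, truncVar (μ i))
    {y : ℝ} (hy : 0 ≤ y) :
    ∃ C, C ≠ ∞ ∧ ∀ n, walkOp (Set.Ici 0) n μ ENNReal.ofReal y ≤ C := by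
  obtain ⟨N₀, hN₀⟩ := eventually_atTop.1 hv
  set N := max N₀ 1 with hN
  -- Two requirements fix `p`. The barrier increments divided by `√n` are of order `n^{p - 3/2}`,
  -- summable since `p < 1/2`. The moment term carries `n^{-1/2 - p (1 + δ)} = n^{-(1 + δ/4)}`, the
  -- weight in `hm`.
  set p := (1 / 2 + δ / 4) / (1 + δ) with hp
  have hpδ : p * (1 + δ) = 1 / 2 + δ / 4 := div_mul_cancel₀ _ (by positivity)
  have hp0 : 0 < p := by positivity
  have hp2 : p < 1 / 2 := by
    rw [hp, div_lt_iff₀ (by positivity)]; linarith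
  set c' := min (c / 48) (1 / 4) with hc'
  have hc'0 : 0 < c' := by positivity
  set m : ℕ → ℝ≥0∞ := fun n => ∫⁻ x, ENNReal.ofReal (|x| ^ (2 + δ)) ∂μ n with hmdef
  set a : ℕ → ℝ≥0∞ := fun n => ENNReal.ofReal (c' * √n)⁻¹ *
    (ENNReal.ofReal (((n : ℝ) + 1) ^ p - (n : ℝ) ^ p) +
      ENNReal.ofReal ((((n : ℝ) + 1) ^ p) ^ (1 + δ))⁻¹ * m n) with ha
  set W : ℕ → ℝ≥0∞ := fun n =>
    walkOp (Set.Ici 0) n μ (fun t => ENNReal.ofReal (t + (n : ℝ) ^ p)) y with hW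
  have ha_le : ∀ n, a n ≤ ENNReal.ofReal (c'⁻¹ * (n : ℝ) ^ (p - 3 / 2)) +
      ENNReal.ofReal (2 * c'⁻¹) * (ENNReal.ofReal (((n : ℝ) + 1) ^ (-(1 + δ / 4))) * m n) := by
    intro n
    -- At `n = 0` the prefactor is the inverse of `0`, which is `0`, so `a 0 = 0`.
    rcases Nat.eq_zero_or_pos n with rfl | hn
    · simp [ha]
    have hn0 : (0 : ℝ) < n := by exact_mod_cast hn
    have hn1 : (1 : ℝ) ≤ n := by exact_mod_cast hn
    rw [ha]
    simp only
    rw [mul_add]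
    refine add_le_add ?_ ?_
    · rw [← ENNReal.ofReal_mul (by positivity)]
      refine ENNReal.ofReal_le_ofReal ?_
      have h1 : ((n : ℝ) + 1) ^ p - (n : ℝ) ^ p ≤ (n : ℝ) ^ (p - 1) := by
        have e1 : ((n : ℝ) + 1) ^ p = ((n : ℝ) + 1) ^ (p - 1) * (n + 1) := by
          rw [Real.rpow_sub_one (by positivity)]; field_simp
        have e2 : (n : ℝ) ^ p = (n : ℝ) ^ (p - 1) * n := by
          rw [Real.rpow_sub_one (by positivity)]; field_simp
        have h2 : ((n : ℝ) + 1) ^ (p - 1) ≤ (n : ℝ) ^ (p - 1) :=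
          Real.rpow_le_rpow_of_nonpos hn0 (by linarith) (by linarith)
        rw [e1, e2]
        nlinarith
      calc (c' * √n)⁻¹ * (((n : ℝ) + 1) ^ p - (n : ℝ) ^ p)
          ≤ (c' * √n)⁻¹ * (n : ℝ) ^ (p - 1) := by gcongr
        _ = c'⁻¹ * ((n : ℝ) ^ (-(1 / 2) : ℝ) * (n : ℝ) ^ (p - 1)) := by
            rw [mul_inv, Real.sqrt_eq_rpow, Real.rpow_neg hn0.le, mul_assoc]
        _ = _ := by
            rw [← Real.rpow_add hn0]; ring_nf
    · simp only [← mul_assoc]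
      refine mul_le_mul' ?_ le_rfl
      rw [← ENNReal.ofReal_mul (by positivity), ← ENNReal.ofReal_mul (by positivity)]
      refine ENNReal.ofReal_le_ofReal ?_
      have h3 : √((n : ℝ) + 1) ≤ 2 * √n := by
        refine Real.sqrt_le_iff.2 ⟨by positivity, ?_⟩
        rw [mul_pow, Real.sq_sqrt hn0.le]
        linarith
      have h4 : (√n)⁻¹ ≤ 2 * (√((n : ℝ) + 1))⁻¹ := by
        rw [← div_eq_mul_inv, le_div_iff₀ (by positivity), inv_mul_le_iff₀ (by positivity)]
        linarith
      have hq : (0 : ℝ) < (n : ℝ) + 1 := by positivity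
      calc (c' * √n)⁻¹ * ((((n : ℝ) + 1) ^ p) ^ (1 + δ))⁻¹
          = c'⁻¹ * ((√n)⁻¹ * ((n : ℝ) + 1) ^ (-(1 / 2 + δ / 4))) := by
            rw [mul_inv, ← Real.rpow_mul hq.le, hpδ, Real.rpow_neg hq.le, mul_assoc]
        _ ≤ c'⁻¹ * ((2 * (√((n : ℝ) + 1))⁻¹) * ((n : ℝ) + 1) ^ (-(1 / 2 + δ / 4))) := by gcongr
        _ = 2 * c'⁻¹ * (((n : ℝ) + 1) ^ (-(1 / 2) : ℝ) *
              ((n : ℝ) + 1) ^ (-(1 / 2 + δ / 4))) := by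
            rw [Real.sqrt_eq_rpow, ← Real.rpow_neg hq.le]; ring
        _ = _ := by rw [← Real.rpow_add hq]; ring_nf
  have ha_sum : ∑' n, a n ≠ ∞ := by
    refine ne_top_of_le_ne_top ?_ (ENNReal.tsum_le_tsum ha_le)
    rw [ENNReal.tsum_add, ENNReal.tsum_mul_left]
    refine ENNReal.add_ne_top.2 ⟨?_, ENNReal.mul_ne_top ENNReal.ofReal_ne_top hm⟩
    have hs : Summable fun n : ℕ => c'⁻¹ * (n : ℝ) ^ (p - 3 / 2) :=
      (Real.summable_nat_rpow.2 (by linarith)).mul_left _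
    exact hs.tsum_ofReal_ne_top
  obtain ⟨C, hC, hWC⟩ := exists_bound_of_le_mul_one_add (W := W) (N := N) ha_sum
    (walkOp_Ici_ofReal_add_ne_top hi N hy _) (by
      intro n hn
      have hn1 : 1 ≤ n := (le_max_right _ _).trans hn
      have hn0 : (0 : ℝ) < n := by exact_mod_cast hn1
      have hE := walkOp_univ_ofReal_ge hi h0 hc hn1 (hN₀ n ((le_max_left _ _).trans hn))
      have := walkOp_Ici_succ_le hi h0 hδ hy (n := n) (b := (n : ℝ) ^ p)
        (b' := ((n : ℝ) + 1) ^ p) (by positivity)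
        (Real.rpow_le_rpow hn0.le (by linarith) hp0.le) (by positivity) (by positivity) hE
      rw [hW]
      simp only [Nat.cast_add, Nat.cast_one]
      exact this)
  refine ⟨C, hC, fun n => ?_⟩
  -- The Grönwall bound starts only at `N`; smaller times are covered by monotonicity in `n`.
  calc walkOp (Set.Ici 0) n μ ENNReal.ofReal y
      ≤ walkOp (Set.Ici 0) (max n N) μ ENNReal.ofReal y :=
        monotone_walkOp_Ici_ofReal hi h0 hy (le_max_left _ _)
    _ ≤ W (max n N) := walkOp_mono
        (fun z _ => ENNReal.ofReal_le_ofReal (le_add_of_nonneg_right (by positivity))) _ μ y hy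
    _ ≤ C := hWC _ (le_max_right _ _)

end Killed

variable {E : Type*} [MeasurableSpace E]

/-! ### The step law and the harmonic function -/

theorem childSum_add (f g : ℝ → ℝ≥0∞) (c : Offspring) :
    childSum (fun x => f x + g x) c = childSum f c + childSum g c := by
  rw [childSum, childSum, childSum, ← ENNReal.tsum_add]
  exact tsum_congr fun k => by cases c k <;> simp

theorem childSum_const_mul (a : ℝ≥0∞) (f : ℝ → ℝ≥0∞) (c : Offspring) :
    childSum (fun x => a * f x) c = a * childSum f c := by
  rw [childSum, childSum, ← ENNReal.tsum_mul_left]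
  exact tsum_congr fun k => by cases c k <;> simp

theorem childSum_iSup {f : ℕ → ℝ → ℝ≥0∞} (hf : Monotone f) (c : Offspring) :
    childSum (fun x => ⨆ n, f n x) c = ⨆ n, childSum (f n) c := by
  have h : ∀ k, (c k).elim 0 (fun x => ⨆ n, f n x) = ⨆ n, (c k).elim 0 (f n) := fun k => by
    cases c k <;> simp
  simp only [childSum, h]
  simp only [← lintegral_count]
  refine lintegral_iSup (fun n => measurable_of_countable _) fun m n hmn k => ?_
  cases c k with
  | none => simp
  | some x => exact hf hmn x

theorem stepLaw_apply (𝓛 : Kernel E Offspring) (e : E) {B : Set ℝ} (hB : MeasurableSet B) :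
    stepLaw 𝓛 e B =
      ∫⁻ c, childSum (B.indicator fun x => ENNReal.ofReal (Real.exp (-x))) c ∂𝓛 e :=
  Measure.ofMeasurable_apply B hB

/-- The many-to-one formula for one generation, from indicators to measurable functions. -/
theorem lintegral_stepLaw (𝓛 : Kernel E Offspring) (e : E) {f : ℝ → ℝ≥0∞} (hf : Measurable f) :
    ∫⁻ x, f x ∂stepLaw 𝓛 e =
      ∫⁻ c, childSum (fun x => f x * ENNReal.ofReal (Real.exp (-x))) c ∂𝓛 e := by
  have hexp : Measurable fun x : ℝ => ENNReal.ofReal (Real.exp (-x)) := by fun_prop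
  refine Measurable.ennreal_induction ?_ ?_ ?_ hf
  · intro a s hs
    rw [lintegral_indicator_const hs, stepLaw_apply 𝓛 e hs,
      ← lintegral_const_mul _ (measurable_childSum (hexp.indicator hs))]
    refine lintegral_congr fun c => ?_
    rw [← childSum_const_mul]
    congr 1
    funext x
    by_cases hx : x ∈ s <;> simp [hx]
  · intro f g _ hf hg ihf ihg
    simp only [Pi.add_apply, add_mul]
    have hm : Measurable fun x => f x * ENNReal.ofReal (Real.exp (-x)) := hf.mul hexp
    rw [lintegral_add_left hf, ihf, ihg, ← lintegral_add_left (measurable_childSum hm)]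
    refine lintegral_congr fun c => ?_
    rw [← childSum_add]
  · intro f hf hmono ih
    have hmono' : Monotone fun n x => f n x * ENNReal.ofReal (Real.exp (-x)) :=
      fun m n hmn x => mul_le_mul_left (hmono hmn x) _
    simp only [ENNReal.iSup_mul]
    rw [lintegral_iSup hf hmono]
    simp only [childSum_iSup hmono', ih]
    refine (lintegral_iSup (fun n => measurable_childSum ((hf n).mul hexp)) ?_).symm
    intro m n hmn c
    refine ENNReal.tsum_le_tsum fun k => ?_
    cases c k with
    | none => simp
    | some x => exact hmono' hmn x

theorem isProbabilityMeasure_stepLaw {𝓛 : Kernel E Offspring} {e : E}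
    (h : ∫⁻ c, childSum (fun x => ENNReal.ofReal (Real.exp (-x))) c ∂𝓛 e = 1) :
    IsProbabilityMeasure (stepLaw 𝓛 e) :=
  ⟨by rw [stepLaw_apply 𝓛 e MeasurableSet.univ]; simpa using h⟩

theorem measurable_cons :
    Measurable fun (p : ℝ × (ℕ → ℝ)) (n : ℕ) => (Nat.casesOn n p.1 p.2 : ℝ) := by
  refine measurable_pi_lambda _ fun n => ?_
  cases n with
  | zero => exact measurable_fst
  | succ n => exact (measurable_pi_apply n).comp measurable_snd

theorem map_cons_infinitePi (μ : ℕ → Measure ℝ) [∀ i, IsProbabilityMeasure (μ i)] :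
    ((μ 0).prod (Measure.infinitePi fun i => μ (i + 1))).map
      (fun p n => Nat.casesOn n p.1 p.2) = Measure.infinitePi μ := by
  have hm := measurable_cons
  refine Measure.eq_infinitePi _ fun s t ht => ?_
  classical
  obtain ⟨n, hn⟩ := s.exists_nat_subset_range
  set t' : ℕ → Set ℝ := fun i => if i ∈ s then t i else Set.univ with ht'
  have ht'm : ∀ i, MeasurableSet (t' i) := fun i => by
    by_cases hi : i ∈ s <;> simp [ht', hi, ht i]
  have h1 : Set.pi (s : Set ℕ) t = Set.pi (Finset.range (n + 1) : Set ℕ) t' := by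
    ext x
    simp only [Set.mem_pi, Finset.mem_coe, ht']
    constructor
    · intro h i _
      by_cases hi : i ∈ s
      · simpa [hi] using h i hi
      · simp [hi]
    · intro h i hi
      have := h i (Finset.mem_range.2 ((Finset.mem_range.1 (hn hi)).trans n.lt_succ_self))
      simpa [hi] using this
  have h2 : ∏ i ∈ s, μ i (t i) = ∏ i ∈ Finset.range (n + 1), μ i (t' i) := by
    rw [← Finset.prod_subset (hn.trans (Finset.range_subset_range.2 n.le_succ)) fun i _ hi => by
      simp [ht', hi]]
    exact Finset.prod_congr rfl fun i hi => by simp [ht', hi]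
  rw [h1, h2, Measure.map_apply hm (MeasurableSet.pi (Finset.countable_toSet _) fun i _ => ht'm i),
    Finset.prod_range_succ', ← Measure.infinitePi_pi (μ := fun i => μ (i + 1))
      (t := fun i => t' (i + 1)) (s := Finset.range n) fun i _ => ht'm _, mul_comm,
    ← Measure.prod_prod]
  congr 1
  ext p
  simp only [Set.mem_preimage, Set.mem_pi, Finset.coe_range, Set.mem_Iio, Set.mem_prod]
  constructor
  · exact fun h => ⟨h 0 (by omega), fun i hi => h (i + 1) (by omega)⟩
  · rintro ⟨h0, hs⟩ i hi
    cases i with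
    | zero => exact h0
    | succ i => exact hs i (by omega)

/-- Splitting off the first coordinate of the infinite product turns the path-space definition into
the operator recursion, on which all the estimates are made. -/
theorem harmonicApprox_eq_walkOp (𝓛 : Kernel E Offspring) (n : ℕ) :
    ∀ (s : ℕ → E), (∀ i, IsProbabilityMeasure (stepLaw 𝓛 (s i))) → ∀ y : ℝ,
    harmonicApprox 𝓛 s n y =
      walkOp (Set.Ici 0) n (fun i => stepLaw 𝓛 (s i)) ENNReal.ofReal y := by
  have hw : ∀ k, Measurable fun x : ℕ → ℝ => walk x k := fun k => by unfold walk; fun_prop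
  have hset : ∀ n y, MeasurableSet {x : ℕ → ℝ | ∀ k, 1 ≤ k → k ≤ n → 0 ≤ y + walk x k} := by
    intro n y
    simp only [Set.ofPred_forall]
    exact MeasurableSet.iInter fun k => MeasurableSet.iInter fun _ => MeasurableSet.iInter fun _ =>
      measurableSet_le measurable_const ((hw k).const_add y)
  induction n with
  | zero =>
    intro s hs y
    have hx : ∀ x : ℕ → ℝ, x ∈ {x : ℕ → ℝ | ∀ k, 1 ≤ k → k ≤ 0 → 0 ≤ y + walk x k} :=
      fun x k h1 h2 => by omega
    rw [harmonicApprox, walkLaw]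
    refine (lintegral_congr fun x => Set.indicator_of_mem (hx x) _).trans ?_
    simp [walkOp, walk]
  | succ n ih =>
    intro s hs y
    have hF : ∀ n y, Measurable fun x : ℕ → ℝ =>
        {x : ℕ → ℝ | ∀ k, 1 ≤ k → k ≤ n → 0 ≤ y + walk x k}.indicator
          (fun x => ENNReal.ofReal (y + walk x n)) x := fun n y =>
      (Measurable.ennreal_ofReal ((hw n).const_add y)).indicator (hset n y)
    rw [harmonicApprox, walkLaw, ← map_cons_infinitePi, lintegral_map (hF _ _) measurable_cons]
    have hF' := (hF (n + 1) y).comp measurable_cons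
    refine (lintegral_prod _ hF'.aemeasurable).trans ?_
    rw [walkOp, stepOp]
    simp only [Function.comp_apply]
    refine lintegral_congr fun x => ?_
    have hwalk : ∀ (x' : ℕ → ℝ) k, walk (fun n => (Nat.casesOn n x x' : ℝ)) (k + 1) =
        x + walk x' k := fun x' k => by
      rw [walk, Finset.sum_range_succ']
      exact add_comm _ _
    by_cases hx : 0 ≤ y + x
    · rw [Set.indicator_of_mem (show y + x ∈ Set.Ici (0 : ℝ) from hx), ← ih (fun i => s (i + 1))
        (fun i => hs _), harmonicApprox]
      refine lintegral_congr fun x' => ?_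
      have hiff : (fun n => (Nat.casesOn n x x' : ℝ)) ∈
          {x : ℕ → ℝ | ∀ k, 1 ≤ k → k ≤ n + 1 → 0 ≤ y + walk x k} ↔
          x' ∈ {x' : ℕ → ℝ | ∀ k, 1 ≤ k → k ≤ n → 0 ≤ y + x + walk x' k} := by
        constructor
        · intro h k h1 h2
          have := h (k + 1) (by omega) (by omega)
          rw [hwalk] at this
          linarith
        · intro h k h1 h2
          obtain ⟨j, rfl⟩ : ∃ j, k = j + 1 := ⟨k - 1, by omega⟩
          rw [hwalk]
          rcases Nat.eq_zero_or_pos j with rfl | hj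
          · simpa [walk] using hx
          · have := h j hj (by omega)
            linarith
      by_cases h : x' ∈ {x' : ℕ → ℝ | ∀ k, 1 ≤ k → k ≤ n → 0 ≤ y + x + walk x' k}
      · rw [Set.indicator_of_mem h, Set.indicator_of_mem (hiff.2 h), hwalk, add_assoc]
      · rw [Set.indicator_of_notMem h, Set.indicator_of_notMem (fun h' => h (hiff.1 h'))]
    · rw [Set.indicator_of_notMem (show y + x ∉ Set.Ici (0 : ℝ) from hx)]
      refine (lintegral_congr fun x' => ?_).trans lintegral_zero
      refine Set.indicator_of_notMem (fun h => hx ?_) _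
      have := h 1 le_rfl (by omega)
      rw [hwalk] at this
      simpa [walk] using this

/-- The quenched assumptions on the increments of the associated random walk. -/
structure CenteredEnv (𝓛 : Kernel E Offspring) (s : ℕ → E) : Prop where
  prob : ∀ i, IsProbabilityMeasure (stepLaw 𝓛 (s i))
  integrable : ∀ i, Integrable id (stepLaw 𝓛 (s i))
  mean : ∀ i, ∫ x, x ∂stepLaw 𝓛 (s i) = 0
  pos : ∀ i, stepLaw 𝓛 (s i) (Set.Ioi 0) ≠ 0

namespace CenteredEnv

variable {𝓛 : Kernel E Offspring} {s : ℕ → E}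

theorem shift (h : CenteredEnv 𝓛 s) (n : ℕ) : CenteredEnv 𝓛 (BRW.shift n s) :=
  ⟨fun _ => h.prob _, fun _ => h.integrable _, fun _ => h.mean _, fun _ => h.pos _⟩

theorem monotone_harmonicApprox (h : CenteredEnv 𝓛 s) {y : ℝ} (hy : 0 ≤ y) :
    Monotone fun n => harmonicApprox 𝓛 s n y := by
  have := h.prob
  simp only [harmonicApprox_eq_walkOp 𝓛 _ s h.prob]
  exact monotone_walkOp_Ici_ofReal h.integrable h.mean hy

/-- The `limsup` is a true limit because the approximations increase. -/
theorem harmonic_eq_iSup (h : CenteredEnv 𝓛 s) {y : ℝ} (hy : 0 ≤ y) :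
    harmonic 𝓛 s y = ⨆ n, harmonicApprox 𝓛 s n y :=
  (tendsto_atTop_iSup (h.monotone_harmonicApprox hy)).limsup_eq

/-- Monotone convergence in the first-step recursion. Finiteness is not needed, so this can also be
used to prove finiteness for shifted environments. -/
theorem stepOp_harmonic (h : CenteredEnv 𝓛 s) {y : ℝ} (hy : 0 ≤ y) :
    stepOp (Set.Ici 0) (stepLaw 𝓛 (s 0)) (harmonic 𝓛 (BRW.shift 1 s)) y = harmonic 𝓛 s y := by
  have hp := h.prob
  have hsucc : ∀ n, harmonicApprox 𝓛 s (n + 1) y =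
      ∫⁻ x, (Set.Ici 0).indicator (harmonicApprox 𝓛 (BRW.shift 1 s) n) (y + x)
        ∂stepLaw 𝓛 (s 0) := by
    intro n
    have e : harmonicApprox 𝓛 (BRW.shift 1 s) n = walkOp (Set.Ici 0) n
        (fun i => stepLaw 𝓛 (s (i + 1))) ENNReal.ofReal :=
      funext (harmonicApprox_eq_walkOp 𝓛 n (BRW.shift 1 s) (h.shift 1).prob)
    rw [harmonicApprox_eq_walkOp 𝓛 _ s h.prob, e]
    rfl
  have hmeas : ∀ n, Measurable (harmonicApprox 𝓛 (BRW.shift 1 s) n) := by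
    intro n
    have e : harmonicApprox 𝓛 (BRW.shift 1 s) n = walkOp (Set.Ici 0) n
        (fun i => stepLaw 𝓛 (s (i + 1))) ENNReal.ofReal :=
      funext (harmonicApprox_eq_walkOp 𝓛 n (BRW.shift 1 s) (h.shift 1).prob)
    rw [e]
    exact measurable_walkOp measurableSet_Ici ENNReal.measurable_ofReal n _
  rw [h.harmonic_eq_iSup hy, ← (h.monotone_harmonicApprox hy).iSup_nat_add 1]
  simp only [hsucc]
  have hmeas' : ∀ n, Measurable fun x =>
      (Set.Ici 0).indicator (harmonicApprox 𝓛 (BRW.shift 1 s) n) (y + x) :=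
    fun n => ((hmeas n).indicator measurableSet_Ici).comp (by fun_prop)
  rw [← lintegral_iSup hmeas', stepOp]
  · refine lintegral_congr fun x => ?_
    by_cases hx : y + x ∈ Set.Ici (0 : ℝ)
    · simp [hx, (h.shift 1).harmonic_eq_iSup hx]
    · simp [hx]
  · intro m n hmn x
    by_cases hx : y + x ∈ Set.Ici (0 : ℝ)
    · simpa [hx] using (h.shift 1).monotone_harmonicApprox hx hmn
    · simp [hx]

/-- The first approximation is already positive: an upward step has positive probability and ends
strictly above `0`, even from `y = 0`. -/
theorem harmonic_ne_zero (h : CenteredEnv 𝓛 s) {y : ℝ} (hy : 0 ≤ y) : harmonic 𝓛 s y ≠ 0 := by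
  intro h0
  rw [h.harmonic_eq_iSup hy, ENNReal.iSup_eq_zero] at h0
  have h1 := h0 1
  rw [harmonicApprox_eq_walkOp 𝓛 _ s h.prob] at h1
  refine h.pos 0 ?_
  have hm : Measurable fun x => (Set.Ici 0).indicator ENNReal.ofReal (y + x) :=
    (ENNReal.measurable_ofReal.indicator measurableSet_Ici).comp (by fun_prop)
  have h2 := (lintegral_eq_zero_iff hm).1 h1
  refine measure_mono_null (fun x (hx : 0 < x) => ?_) (ae_iff.1 h2)
  have hx' : y + x ∈ Set.Ici (0 : ℝ) := by
    change 0 ≤ y + x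
    linarith
  simp only [Set.mem_ofPred_eq, Set.indicator_of_mem hx', Pi.zero_apply, ENNReal.ofReal_eq_zero,
    not_le]
  linarith

/-- If `U(θs, y) = ∞`, then `U(θs, ·) = ∞` on `[y, ∞)` by monotonicity. An upward step reaches this
set with positive probability, so harmonicity forces `U(s, y) = ∞`. -/
theorem harmonic_shift_one_ne_top (h : CenteredEnv 𝓛 s)
    (hfin : ∀ y, 0 ≤ y → harmonic 𝓛 s y ≠ ∞) {y : ℝ} (hy : 0 ≤ y) :
    harmonic 𝓛 (BRW.shift 1 s) y ≠ ∞ := by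
  intro htop
  refine hfin y hy ?_
  rw [← h.stepOp_harmonic hy, ← top_le_iff]
  calc ∞ = ∞ * stepLaw 𝓛 (s 0) (Set.Ioi 0) := (ENNReal.top_mul (h.pos 0)).symm
    _ = ∫⁻ x, (Set.Ioi 0).indicator (fun _ => ∞) x ∂stepLaw 𝓛 (s 0) :=
        (lintegral_indicator_const measurableSet_Ioi _).symm
    _ ≤ _ := lintegral_mono fun x => by
        by_cases hx : 0 < x
        · have hx' : y + x ∈ Set.Ici (0 : ℝ) := by
            change 0 ≤ y + x
            linarith
          have : harmonic 𝓛 (BRW.shift 1 s) (y + x) = ∞ :=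
            top_le_iff.1 (htop ▸ monotone_harmonic 𝓛 _ (by linarith))
          simp [hx', this]
        · simp [hx]

theorem harmonic_shift_ne_top (h : CenteredEnv 𝓛 s)
    (hfin : ∀ y, 0 ≤ y → harmonic 𝓛 s y ≠ ∞) (n : ℕ) :
    ∀ y, 0 ≤ y → harmonic 𝓛 (BRW.shift n s) y ≠ ∞ := by
  induction n with
  | zero => exact hfin
  | succ n ih =>
    intro y hy
    have e : BRW.shift (n + 1) s = BRW.shift 1 (BRW.shift n s) := by
      funext i
      simp only [BRW.shift]
      congr 1
      omega
    rw [e]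
    exact (h.shift n).harmonic_shift_one_ne_top ih hy

theorem harmonic_ne_top (h : CenteredEnv 𝓛 s) {δ c : ℝ} (hδ : 0 < δ) (hc : 0 < c)
    (hm : ∑' n : ℕ, ENNReal.ofReal (((n : ℝ) + 1) ^ (-(1 + δ / 4))) *
      ∫⁻ x, ENNReal.ofReal (|x| ^ (2 + δ)) ∂stepLaw 𝓛 (s n) ≠ ∞)
    (hv : ∀ᶠ n : ℕ in atTop, c * n ≤ ∑ i ∈ Finset.range n, truncVar (stepLaw 𝓛 (s i)))
    {y : ℝ} (hy : 0 ≤ y) : harmonic 𝓛 s y ≠ ∞ := by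
  have := h.prob
  obtain ⟨C, hC, hle⟩ := exists_bound_walkOp_Ici h.integrable h.mean hδ hc hm hv hy
  rw [h.harmonic_eq_iSup hy]
  refine ne_top_of_le_ne_top hC (iSup_le fun n => ?_)
  rw [harmonicApprox_eq_walkOp 𝓛 _ s h.prob]
  exact hle n

end CenteredEnv

/-! ### Almost every environment is good -/

theorem measurable_lintegral_stepLaw (𝓛 : Kernel E Offspring) {f : ℝ → ℝ≥0∞} (hf : Measurable f) :
    Measurable fun e => ∫⁻ x, f x ∂stepLaw 𝓛 e := by
  simp only [lintegral_stepLaw 𝓛 _ hf]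
  have hm : Measurable fun x => f x * ENNReal.ofReal (Real.exp (-x)) := hf.mul (by fun_prop)
  exact (measurable_childSum hm).lintegral_kernel

/-- The integral condition on the offspring law says that the step law is centered. -/
theorem lintegral_stepLaw_pos_eq_neg {𝓛 : Kernel E Offspring} {e : E}
    (hint : ∫⁻ x, ENNReal.ofReal |x| ∂stepLaw 𝓛 e ≠ ∞)
    (h : ∫ c, ∑' k, (c k).elim 0 (fun x : ℝ => x * Real.exp (-x)) ∂𝓛 e = 0) :
    ∫⁻ x, ENNReal.ofReal x ∂stepLaw 𝓛 e = ∫⁻ x, ENNReal.ofReal (-x) ∂stepLaw 𝓛 e := by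
  set g : ℝ → ℝ≥0∞ := fun x => ENNReal.ofReal x * ENNReal.ofReal (Real.exp (-x)) with hg
  set g' : ℝ → ℝ≥0∞ := fun x => ENNReal.ofReal (-x) * ENNReal.ofReal (Real.exp (-x)) with hg'
  have mg : Measurable g := by fun_prop
  have mg' : Measurable g' := by fun_prop
  have f1 : ∫⁻ x, ENNReal.ofReal x ∂stepLaw 𝓛 e ≠ ∞ :=
    ne_top_of_le_ne_top hint (lintegral_mono fun x => ENNReal.ofReal_le_ofReal (le_abs_self x))
  have f2 : ∫⁻ x, ENNReal.ofReal (-x) ∂stepLaw 𝓛 e ≠ ∞ :=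
    ne_top_of_le_ne_top hint (lintegral_mono fun x => ENNReal.ofReal_le_ofReal (neg_le_abs x))
  rw [lintegral_stepLaw 𝓛 e (by fun_prop)] at f1 f2 ⊢
  rw [lintegral_stepLaw 𝓛 e (by fun_prop)]
  have a1 := ae_lt_top (measurable_childSum mg) f1
  have a2 := ae_lt_top (measurable_childSum mg') f2
  -- A real `∑'` is `0` by default when the series is not summable. Almost sure finiteness of both
  -- one-sided sums excludes this and makes it a genuine difference.
  have hsplit : ∀ᵐ c ∂𝓛 e, ∑' k, (c k).elim 0 (fun x : ℝ => x * Real.exp (-x)) =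
      (childSum g c).toReal - (childSum g' c).toReal := by
    filter_upwards [a1, a2] with c h1 h2
    have t1 : ∀ k, (c k).elim 0 g ≠ ∞ := ENNReal.ne_top_of_tsum_ne_top h1.ne
    have t2 : ∀ k, (c k).elim 0 g' ≠ ∞ := ENNReal.ne_top_of_tsum_ne_top h2.ne
    rw [childSum, childSum, ENNReal.tsum_toReal_eq t1, ENNReal.tsum_toReal_eq t2,
      ← (ENNReal.summable_toReal h1.ne).tsum_sub (ENNReal.summable_toReal h2.ne)]
    refine tsum_congr fun k => ?_
    cases c k with
    | none => simp
    | some x =>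
      simp only [Option.elim_some, hg, hg', ENNReal.toReal_mul, ENNReal.toReal_ofReal',
        ← sub_mul, max_eq_left (Real.exp_pos (-x)).le]
      congr 1
      rcases le_total 0 x with hx | hx
      · rw [max_eq_left hx, max_eq_right (by linarith)]; ring
      · rw [max_eq_right hx, max_eq_left (by linarith)]; ring
  rw [integral_congr_ae hsplit, integral_sub
    (integrable_toReal_of_lintegral_ne_top (measurable_childSum mg).aemeasurable f1)
    (integrable_toReal_of_lintegral_ne_top (measurable_childSum mg').aemeasurable f2),
    integral_toReal (measurable_childSum mg).aemeasurable a1,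
    integral_toReal (measurable_childSum mg').aemeasurable a2, sub_eq_zero,
    ENNReal.toReal_eq_toReal_iff' f1 f2] at h
  exact h

theorem centered_of_lintegral_eq {ν : Measure ℝ} (hint : ∫⁻ x, ENNReal.ofReal |x| ∂ν ≠ ∞)
    (h : ∫⁻ x, ENNReal.ofReal x ∂ν = ∫⁻ x, ENNReal.ofReal (-x) ∂ν) :
    Integrable id ν ∧ ∫ x, x ∂ν = 0 := by
  have hi : Integrable (fun x : ℝ => x) ν := by
    refine ⟨measurable_id.aestronglyMeasurable, ?_⟩
    rw [hasFiniteIntegral_iff_norm]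
    exact lt_top_iff_ne_top.2 hint
  refine ⟨hi, ?_⟩
  rw [integral_eq_lintegral_pos_part_sub_lintegral_neg_part hi, h, sub_self]

theorem ofReal_abs_le_one_add {δ : ℝ} (hδ : 0 < δ) (x : ℝ) :
    ENNReal.ofReal |x| ≤ 1 + ENNReal.ofReal (|x| ^ (2 + δ)) := by
  rw [← ENNReal.ofReal_one, ← ENNReal.ofReal_add zero_le_one (by positivity)]
  refine ENNReal.ofReal_le_ofReal ?_
  rcases le_total |x| 1 with hx | hx
  · have : 0 ≤ |x| ^ (2 + δ) := by positivity
    linarith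
  · have := Real.self_le_rpow_of_one_le hx (by linarith : 1 ≤ 2 + δ)
    linarith

theorem truncVar_pos {ν : Measure ℝ} [IsFiniteMeasure ν] (h : ν (Set.Ioi 0) ≠ 0) :
    0 < truncVar ν := by
  refine (truncVar_nonneg ν).lt_of_ne' fun h0 => h ?_
  have h1 := (integral_eq_zero_iff_of_nonneg (fun x => by positivity) (integrable_min_sq ν)).1 h0
  refine measure_mono_null (fun x (hx : 0 < x) => ?_) (ae_iff.1 h1)
  have : 0 < min (x ^ 2) 1 := by positivity
  exact this.ne'

section Ae

variable {Ω : Type*} [MeasurableSpace Ω] {P : Measure Ω} {ξ : ℕ → Ω → E}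

theorem ae_forall_of_identDistrib (hξd : ∀ n, IdentDistrib (ξ n) (ξ 0) P P) {p : E → Prop}
    (hp : MeasurableSet {e | p e}) (h : ∀ᵐ ω ∂P, p (ξ 0 ω)) : ∀ᵐ ω ∂P, ∀ n, p (ξ n ω) :=
  ae_all_iff.2 fun n => (hξd n).symm.ae_snd hp h

/-- The expectation of the series is `∑ (n+1)^{-r}` times the mean of `m (ξ 0)`, which is finite. -/
theorem ae_tsum_ne_top (hξd : ∀ n, IdentDistrib (ξ n) (ξ 0) P P) {m : E → ℝ≥0∞}
    (hm : Measurable m) (hint : ∫⁻ ω, m (ξ 0 ω) ∂P ≠ ∞) {r : ℝ} (hr : 1 < r) :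
    ∀ᵐ ω ∂P, ∑' n : ℕ, ENNReal.ofReal (((n : ℝ) + 1) ^ (-r)) * m (ξ n ω) ≠ ∞ := by
  have hmeas : ∀ n : ℕ, AEMeasurable
      (fun ω => ENNReal.ofReal (((n : ℝ) + 1) ^ (-r)) * m (ξ n ω)) P := fun n =>
    (hm.comp_aemeasurable (hξd n).aemeasurable_fst).const_mul _
  have hs : Summable fun n : ℕ => ((n : ℝ) + 1) ^ (-r) := by
    have := (summable_nat_add_iff 1).2 (Real.summable_nat_rpow.2 (by linarith : -r < -1))
    simpa using this
  have hfin : ∫⁻ ω, ∑' n : ℕ, ENNReal.ofReal (((n : ℝ) + 1) ^ (-r)) * m (ξ n ω) ∂P ≠ ∞ := by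
    rw [lintegral_tsum hmeas]
    have e : ∀ n : ℕ, ∫⁻ ω, ENNReal.ofReal (((n : ℝ) + 1) ^ (-r)) * m (ξ n ω) ∂P =
        ENNReal.ofReal (((n : ℝ) + 1) ^ (-r)) * ∫⁻ ω, m (ξ 0 ω) ∂P := fun n => by
      rw [lintegral_const_mul' _ _ ENNReal.ofReal_ne_top]
      congr 1
      exact ((hξd n).comp hm).lintegral_eq
    simp only [e]
    rw [ENNReal.tsum_mul_right]
    exact ENNReal.mul_ne_top hs.tsum_ofReal_ne_top hint
  filter_upwards [ae_lt_top' (AEMeasurable.tsum hmeas) hfin] with ω hω using hω.ne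

/-- The strong law of large numbers, with `c` half of the positive mean. -/
theorem ae_eventually_le_sum [IsProbabilityMeasure P] (hξi : iIndepFun ξ P)
    (hξd : ∀ n, IdentDistrib (ξ n) (ξ 0) P P) {v : E → ℝ} (hv : Measurable v)
    (h1 : ∀ᵐ ω ∂P, v (ξ 0 ω) ≤ 1) (h0 : ∀ᵐ ω ∂P, 0 < v (ξ 0 ω)) :
    ∃ c : ℝ, 0 < c ∧ ∀ᵐ ω ∂P, ∀ᶠ n : ℕ in atTop, c * n ≤ ∑ i ∈ Finset.range n, v (ξ i ω) := by
  have hint : Integrable (fun ω => v (ξ 0 ω)) P := by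
    refine Integrable.of_bound (hv.comp_aemeasurable (hξd 0).aemeasurable_fst).aestronglyMeasurable
      1 ?_
    filter_upwards [h1, h0] with ω h1 h0
    rwa [Real.norm_of_nonneg h0.le]
  have hpos : 0 < ∫ ω, v (ξ 0 ω) ∂P := by
    have hnn : 0 ≤ᵐ[P] fun ω => v (ξ 0 ω) := h0.mono fun ω h => h.le
    refine (integral_nonneg_of_ae hnn).lt_of_ne' fun hz => ?_
    obtain ⟨ω, hω, hω'⟩ := (((integral_eq_zero_iff_of_nonneg_ae hnn hint).1 hz).and h0).exists
    exact hω'.ne' hω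
  refine ⟨(∫ ω, v (ξ 0 ω) ∂P) / 2, by positivity, ?_⟩
  have hlaw := strong_law_ae_real (fun n ω => v (ξ n ω)) hint
    (fun i j hij => (hξi.indepFun hij).comp hv hv) (fun n => (hξd n).comp hv)
  filter_upwards [hlaw] with ω hω
  filter_upwards [hω.eventually (lt_mem_nhds (half_lt_self hpos)), eventually_gt_atTop 0]
    with n hn hn0
  have : (0 : ℝ) < n := by exact_mod_cast hn0
  exact ((lt_div_iff₀ this).1 hn).le

/-- Under the assumptions of the spinal decomposition, almost every environment is centered and
has a finite harmonic function. -/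
theorem ae_centeredEnv_and_harmonic_ne_top [IsProbabilityMeasure P] (𝓛 : Kernel E Offspring)
    (hξi : iIndepFun ξ P) (hξd : ∀ n, IdentDistrib (ξ n) (ξ 0) P P)
    (hpos : ∀ᵐ ω ∂P, 0 < ∫⁻ c, childSum
      (fun x => if 0 < x then ENNReal.ofReal (Real.exp (-x)) else 0) c ∂𝓛 (ξ 0 ω))
    (hboundary₀ : ∀ᵐ ω ∂P,
      ∫⁻ c, childSum (fun x => ENNReal.ofReal (Real.exp (-x))) c ∂𝓛 (ξ 0 ω) = 1)
    (hboundary₁ : ∀ᵐ ω ∂P,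
      ∫ c, ∑' k, (c k).elim 0 (fun x : ℝ => x * Real.exp (-x)) ∂𝓛 (ξ 0 ω) = 0)
    {δ : ℝ} (hδ : 0 < δ) (hmoment : ∫⁻ ω, ∫⁻ c, childSum
      (fun x => ENNReal.ofReal (|x| ^ (2 + δ) * Real.exp (-x))) c ∂𝓛 (ξ 0 ω) ∂P < ∞) :
    ∀ᵐ ω ∂P, CenteredEnv 𝓛 (fun n => ξ n ω) ∧
      ∀ y, 0 ≤ y → harmonic 𝓛 (fun n => ξ n ω) y ≠ ∞ := by
  have mlint : ∀ {f : ℝ → ℝ≥0∞}, Measurable f →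
      Measurable fun e => ∫⁻ x, f x ∂stepLaw 𝓛 e := measurable_lintegral_stepLaw 𝓛
  have mabs : Measurable fun x : ℝ => ENNReal.ofReal (|x| ^ (2 + δ)) := by fun_prop
  have hmom : ∫⁻ ω, ∫⁻ x, ENNReal.ofReal (|x| ^ (2 + δ)) ∂stepLaw 𝓛 (ξ 0 ω) ∂P ≠ ∞ := by
    refine ne_of_lt (lt_of_eq_of_lt (lintegral_congr fun ω => ?_) hmoment)
    rw [lintegral_stepLaw 𝓛 _ mabs]
    refine lintegral_congr fun c => ?_
    congr 1
    funext x
    rw [ENNReal.ofReal_mul (by positivity)]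
  have hprob₀ : ∀ᵐ ω ∂P, IsProbabilityMeasure (stepLaw 𝓛 (ξ 0 ω)) :=
    hboundary₀.mono fun ω h => isProbabilityMeasure_stepLaw h
  have hpos₀ : ∀ᵐ ω ∂P, stepLaw 𝓛 (ξ 0 ω) (Set.Ioi 0) ≠ 0 := by
    filter_upwards [hpos] with ω h
    rw [stepLaw_apply 𝓛 _ measurableSet_Ioi]
    refine ne_of_gt (lt_of_lt_of_eq h (lintegral_congr fun c => ?_))
    congr 1
  have hmom₀ : ∀ᵐ ω ∂P, ∫⁻ x, ENNReal.ofReal |x| ∂stepLaw 𝓛 (ξ 0 ω) ≠ ∞ := by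
    filter_upwards [hprob₀, ae_lt_top' ((mlint mabs).comp_aemeasurable
      (hξd 0).aemeasurable_fst) hmom] with ω hω hlt
    refine ne_top_of_le_ne_top ?_ (lintegral_mono (ofReal_abs_le_one_add hδ))
    rw [lintegral_add_left measurable_const]
    simpa using hlt.ne
  have hcent₀ : ∀ᵐ ω ∂P, ∫⁻ x, ENNReal.ofReal x ∂stepLaw 𝓛 (ξ 0 ω) =
      ∫⁻ x, ENNReal.ofReal (-x) ∂stepLaw 𝓛 (ξ 0 ω) := by
    filter_upwards [hmom₀, hboundary₁] with ω h h'
    exact lintegral_stepLaw_pos_eq_neg h h'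
  -- Equality in law transfers an almost sure property from `ξ 0` to all `ξ n` if it defines a
  -- measurable set. Each condition is therefore phrased with lower integrals against `stepLaw`,
  -- which are measurable in the environment.
  have hprob : ∀ᵐ ω ∂P, ∀ n, ∫⁻ _, 1 ∂stepLaw 𝓛 (ξ n ω) = 1 :=
    ae_forall_of_identDistrib hξd (p := fun e => ∫⁻ _, 1 ∂stepLaw 𝓛 e = 1)
      (mlint measurable_const (measurableSet_singleton 1))
      (hprob₀.mono fun ω h => by simp)
  have hposn : ∀ᵐ ω ∂P, ∀ n,
      ∫⁻ x, (Set.Ioi 0).indicator (fun _ => 1) x ∂stepLaw 𝓛 (ξ n ω) ≠ 0 :=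
    ae_forall_of_identDistrib hξd
      (p := fun e => ∫⁻ x, (Set.Ioi 0).indicator (fun _ => 1) x ∂stepLaw 𝓛 e ≠ 0)
      (mlint (measurable_const.indicator measurableSet_Ioi) (measurableSet_singleton 0).compl)
      (hpos₀.mono fun ω h => by simpa [lintegral_indicator_const measurableSet_Ioi] using h)
  have hmomn := ae_forall_of_identDistrib hξd
    (p := fun e => ∫⁻ x, ENNReal.ofReal |x| ∂stepLaw 𝓛 e ≠ ∞)
    (mlint (by fun_prop) (measurableSet_singleton ∞).compl) hmom₀
  have hcentn := ae_forall_of_identDistrib hξd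
    (p := fun e => ∫⁻ x, ENNReal.ofReal x ∂stepLaw 𝓛 e = ∫⁻ x, ENNReal.ofReal (-x) ∂stepLaw 𝓛 e)
    (measurableSet_eq_fun (mlint (by fun_prop)) (mlint (by fun_prop))) hcent₀
  have htsum := ae_tsum_ne_top hξd (mlint mabs) hmom (by linarith : 1 < 1 + δ / 4)
  have hv : Measurable fun e => (∫⁻ x, ENNReal.ofReal (min (x ^ 2) 1) ∂stepLaw 𝓛 e).toReal :=
    (mlint (by fun_prop)).ennreal_toReal
  have htrunc : ∀ e, (∫⁻ x, ENNReal.ofReal (min (x ^ 2) 1) ∂stepLaw 𝓛 e).toReal =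
      truncVar (stepLaw 𝓛 e) := fun e =>
    (integral_eq_lintegral_of_nonneg_ae (ae_of_all _ fun x => by positivity)
      (by fun_prop)).symm
  simp only [htrunc] at hv
  obtain ⟨c, hc, hsum⟩ := ae_eventually_le_sum hξi hξd hv
    (hprob₀.mono fun ω h => by
      refine (integral_mono (integrable_min_sq _) (integrable_const 1)
        fun x => min_le_right _ _).trans ?_
      simp)
    (by filter_upwards [hprob₀, hpos₀] with ω h h' using truncVar_pos h')
  filter_upwards [hprob, hposn, hmomn, hcentn, htsum, hsum] with ω h1 h2 h3 h4 h5 h6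
  have hC : CenteredEnv 𝓛 (fun n => ξ n ω) :=
    { prob := fun n => ⟨by simpa using h1 n⟩
      integrable := fun n => (centered_of_lintegral_eq (h3 n) (h4 n)).1
      mean := fun n => (centered_of_lintegral_eq (h3 n) (h4 n)).2
      pos := fun n => by simpa [lintegral_indicator_const measurableSet_Ioi] using h2 n }
  exact ⟨hC, fun y hy => hC.harmonic_ne_top hδ hc h5 h6 hy⟩

end Ae

/-! ### Resampling in infinite products -/

section Resampling

variable {ι X : Type*} [MeasurableSpace X]

/-- Used with `p` selecting the vertices of generation `n`: their offspring can be redrawn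
independently of the earlier generations. -/
theorem map_ite_infinitePi (μ ν : ι → Measure X) [∀ i, IsProbabilityMeasure (μ i)]
    [∀ i, IsProbabilityMeasure (ν i)] (p : ι → Prop) [DecidablePred p] :
    ((Measure.infinitePi μ).prod (Measure.infinitePi ν)).map
      (fun q i => if p i then q.2 i else q.1 i) =
    Measure.infinitePi fun i => if p i then ν i else μ i := by
  have : ∀ i, IsProbabilityMeasure (if p i then ν i else μ i) := fun i => by
    split_ifs <;> infer_instance
  have hm : Measurable fun (q : (ι → X) × (ι → X)) i => if p i then q.2 i else q.1 i := by
    refine measurable_pi_lambda _ fun i => ?_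
    split_ifs <;> fun_prop
  refine Measure.eq_infinitePi _ fun s t ht => ?_
  rw [Measure.map_apply hm (MeasurableSet.pi (Finset.countable_toSet _) fun i _ => ht i)]
  have e : (fun (q : (ι → X) × (ι → X)) i => if p i then q.2 i else q.1 i) ⁻¹'
      Set.pi s t = Set.pi (s.filter fun i => ¬ p i : Finset ι) t ×ˢ
        Set.pi (s.filter p : Finset ι) t := by
    ext q
    simp only [Set.mem_preimage, Set.mem_pi, Finset.mem_coe, Set.mem_prod, Finset.mem_filter]
    constructor
    · intro h
      exact ⟨fun i hi => by simpa [hi.2] using h i hi.1, fun i hi => by simpa [hi.2] using h i hi.1⟩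
    · rintro ⟨h1, h2⟩ i hi
      by_cases hp : p i
      · simpa [hp] using h2 i ⟨hi, hp⟩
      · simpa [hp] using h1 i ⟨hi, hp⟩
  rw [e, Measure.prod_prod, Measure.infinitePi_pi _ fun i _ => ht i,
    Measure.infinitePi_pi _ fun i _ => ht i, ← Finset.prod_filter_mul_prod_filter_not s p, mul_comm]
  congr 1 <;> refine Finset.prod_congr rfl fun i hi => ?_
  · simp [(Finset.mem_filter.1 hi).2]
  · simp [(Finset.mem_filter.1 hi).2]

theorem measurable_update_prod [DecidableEq ι] (j : ι) :
    Measurable fun q : (ι → X) × X => Function.update q.1 j q.2 := by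
  refine measurable_pi_lambda _ fun i => ?_
  by_cases h : i = j
  · subst h; simpa using measurable_snd
  · simp only [Function.update_of_ne h]; fun_prop

/-- Used at the spine vertex, whose offspring is drawn separately from that of the other particles.
-/
theorem map_update_infinitePi [DecidableEq ι] (ν : ι → Measure X)
    [∀ i, IsProbabilityMeasure (ν i)] (j : ι) :
    ((Measure.infinitePi ν).prod (ν j)).map (fun q => Function.update q.1 j q.2) =
      Measure.infinitePi ν := by
  refine Measure.eq_infinitePi _ fun s t ht => ?_
  rw [Measure.map_apply (measurable_update_prod j)
    (MeasurableSet.pi (Finset.countable_toSet _) fun i _ => ht i)]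
  have e : (fun q : (ι → X) × X => Function.update q.1 j q.2) ⁻¹' Set.pi s t =
      Set.pi (s.erase j : Finset ι) t ×ˢ (if j ∈ s then t j else Set.univ) := by
    ext q
    simp only [Set.mem_preimage, Set.mem_pi, Finset.mem_coe, Set.mem_prod, Finset.mem_erase]
    constructor
    · intro h
      refine ⟨fun i hi => by simpa [Function.update_of_ne hi.1] using h i hi.2, ?_⟩
      split_ifs with hj
      · simpa using h j hj
      · trivial
    · rintro ⟨h1, h2⟩ i hi
      by_cases hij : i = j
      · subst hij
        simpa [hi] using h2
      · simpa [Function.update_of_ne hij] using h1 i ⟨hij, hi⟩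
  rw [e, Measure.prod_prod, Measure.infinitePi_pi _ fun i _ => ht i]
  split_ifs with hj
  · exact Finset.prod_erase_mul s _ hj
  · rw [Finset.erase_eq_of_notMem hj]; simp

end Resampling

/-! ### The first `n` generations of the branching random walk -/

/-- The first `n` generations of a marked tree. -/
def cut (n : ℕ) (V : MarkedTree) : MarkedTree := fun u => if u.length ≤ n then V u else none

theorem measurable_cut (n : ℕ) : Measurable (cut n) := by
  refine measurable_pi_lambda _ fun u => ?_
  unfold cut
  split_ifs
  · exact measurable_pi_apply u
  · exact measurable_const

theorem cut_of_le {n : ℕ} {V : MarkedTree} {u : Vertex} (hu : u.length ≤ n) : cut n V u = V u :=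
  if_pos hu

theorem grow_of_le {n : ℕ} (V : MarkedTree) (c : Vertex → Offspring) {u : Vertex}
    (hu : u.length ≤ n) : grow n V c u = V u := by
  cases u with
  | nil => rfl
  | cons k u =>
    have : u.length ≠ n := by
      simp only [List.length_cons] at hu
      omega
    simp [grow, this]

theorem grow_cons {n : ℕ} (V : MarkedTree) (c : Vertex → Offspring) {u : Vertex}
    (hu : u.length = n) (k : ℕ) : grow n V c (k :: u) = childPos (V u) (c u k) := by
  simp [grow, hu]

theorem measurable_grow (n : ℕ) :
    Measurable fun q : MarkedTree × (Vertex → Offspring) => grow n q.1 q.2 := by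
  refine measurable_pi_lambda _ fun u => ?_
  cases u with
  | nil => exact (measurable_pi_apply _).comp measurable_fst
  | cons k u =>
    simp only [grow]
    split_ifs
    · have h : Measurable fun q : MarkedTree × (Vertex → Offspring) => (q.1 u, q.2 u k) := by
        fun_prop
      exact measurable_childPos.comp h
    · exact (measurable_pi_apply _).comp measurable_fst

theorem treeOf_congr {a : ℝ} {L L' : Vertex → Offspring} :
    ∀ u : Vertex, (∀ v : Vertex, v.length < u.length → L v = L' v) → treeOf a L u = treeOf a L' u
  | [], _ => rfl
  | k :: u, h => by
    rw [treeOf, treeOf, h u (by simp), treeOf_congr u fun v hv => h v (by simp; omega)]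

theorem cut_succ_treeOf (a : ℝ) (n : ℕ) (L c : Vertex → Offspring) :
    cut (n + 1) (treeOf a fun u => if u.length = n then c u else L u) =
      grow n (cut n (treeOf a L)) c := by
  have h : ∀ u : Vertex, u.length ≤ n →
      treeOf a (fun u => if u.length = n then c u else L u) u = treeOf a L u :=
    fun u hu => treeOf_congr u fun v hv => if_neg (by omega)
  funext u
  cases u with
  | nil => simp [cut, grow, treeOf]
  | cons k u =>
    by_cases hu : u.length = n
    · rw [grow_cons _ _ hu, cut_of_le hu.le, cut_of_le (by simp [hu]), treeOf, h u hu.le, if_pos hu]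
    · by_cases hu' : u.length < n
      · have hku : (k :: u).length ≤ n := by simpa using hu'
        rw [grow_of_le _ _ hku, cut_of_le hku, cut_of_le (hku.trans n.le_succ), h _ hku]
      · have h1 : ¬ u.length ≤ n := by omega
        have h2 : ¬ u.length + 1 ≤ n := by omega
        simp [cut, grow, hu, h1, h2]

/-- The law of the first `n` generations of the branching random walk. -/
def cutLaw (𝓛 : Kernel E Offspring) (s : ℕ → E) (a : ℝ) (n : ℕ) : Measure MarkedTree :=
  (brwLaw 𝓛 s a).map (cut n)

instance (𝓛 : Kernel E Offspring) [IsMarkovKernel 𝓛] (s : ℕ → E) (a : ℝ) :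
    IsProbabilityMeasure (brwLaw 𝓛 s a) :=
  Measure.isProbabilityMeasure_map (measurable_treeOf a).aemeasurable

instance (𝓛 : Kernel E Offspring) [IsMarkovKernel 𝓛] (s : ℕ → E) (a : ℝ) (n : ℕ) :
    IsProbabilityMeasure (cutLaw 𝓛 s a n) :=
  Measure.isProbabilityMeasure_map (measurable_cut n).aemeasurable

section CutLaw

variable (𝓛 : Kernel E Offspring) [IsMarkovKernel 𝓛] (s : ℕ → E) (a : ℝ)

theorem cutLaw_zero : cutLaw 𝓛 s a 0 = Measure.dirac (rootTree a) := by
  have h : cut 0 ∘ treeOf a = fun _ => rootTree a := by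
    funext L u
    cases u <;> simp [cut, treeOf, rootTree]
  rw [cutLaw, brwLaw, Measure.map_map (measurable_cut 0) (measurable_treeOf a), h,
    Measure.map_const, measure_univ, one_smul]

omit [IsMarkovKernel 𝓛] in
theorem lintegral_cutLaw (n : ℕ) {F : MarkedTree → ℝ≥0∞} (hF : Measurable F) :
    ∫⁻ V, F V ∂cutLaw 𝓛 s a n =
      ∫⁻ L, F (cut n (treeOf a L)) ∂Measure.infinitePi fun u : Vertex => 𝓛 (s u.length) := by
  rw [cutLaw, brwLaw, Measure.map_map (measurable_cut n) (measurable_treeOf a),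
    lintegral_map hF ((measurable_cut n).comp (measurable_treeOf a))]
  rfl

/-- The branching property. Redrawing the offspring of generation `n` preserves the product law, and
the first `n` generations depend only on offspring of earlier vertices. -/
theorem lintegral_cutLaw_succ (n : ℕ) {F : MarkedTree → ℝ≥0∞} (hF : Measurable F) :
    ∫⁻ V, F V ∂cutLaw 𝓛 s a (n + 1) =
      ∫⁻ V, ∫⁻ c, F (grow n V c) ∂Measure.infinitePi (fun _ : Vertex => 𝓛 (s n))
        ∂cutLaw 𝓛 s a n := by
  classical
  have hmix := map_ite_infinitePi (fun u : Vertex => 𝓛 (s u.length)) (fun _ => 𝓛 (s n))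
    (fun u => u.length = n)
  have e : (fun u : Vertex => if u.length = n then 𝓛 (s n) else 𝓛 (s u.length)) =
      fun u => 𝓛 (s u.length) := by
    funext u
    split_ifs with h
    · rw [h]
    · rfl
  have hm : Measurable fun (q : (Vertex → Offspring) × (Vertex → Offspring)) (u : Vertex) =>
      if u.length = n then q.2 u else q.1 u := by
    refine measurable_pi_lambda _ fun i => ?_
    split_ifs <;> fun_prop
  have hFg : Measurable fun q : MarkedTree × (Vertex → Offspring) => F (grow n q.1 q.2) :=
    hF.comp (measurable_grow n)
  have hFt : Measurable fun L => F (cut (n + 1) (treeOf a L)) :=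
    hF.comp ((measurable_cut _).comp (measurable_treeOf a))
  rw [lintegral_cutLaw 𝓛 s a _ hF, lintegral_cutLaw 𝓛 s a _ hFg.lintegral_prod_right']
  simp only [e] at hmix
  conv_lhs => rw [← hmix]
  rw [lintegral_map hFt hm]
  simp only [cut_succ_treeOf]
  have hF2 : Measurable fun q : (Vertex → Offspring) × (Vertex → Offspring) =>
      F (grow n (cut n (treeOf a q.1)) q.2) := by
    refine hFg.comp (Measurable.prodMk ?_ measurable_snd)
    exact ((measurable_cut n).comp (measurable_treeOf a)).comp measurable_fst
  exact lintegral_prod _ hF2.aemeasurable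

end CutLaw

/-! ### Weights -/

section Weights

variable {𝓛 : Kernel E Offspring} {s : ℕ → E} {β : ℝ}

theorem staysAbove_congr {V V' : MarkedTree} {u : Vertex} (h : ∀ v, v <:+ u → V v = V' v) :
    StaysAbove β V u ↔ StaysAbove β V' u :=
  forall₂_congr fun v hv => by rw [h v hv]

theorem staysAbove_cons {V : MarkedTree} {k : ℕ} {u : Vertex} :
    StaysAbove β V (k :: u) ↔ StaysAbove β V u ∧ ∃ x, V (k :: u) = some x ∧ -β ≤ x := by
  simp only [StaysAbove, List.suffix_cons_iff]
  constructor
  · exact fun h => ⟨fun v hv => h v (Or.inr hv), h _ (Or.inl rfl)⟩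
  · rintro ⟨h1, h2⟩ v (rfl | hv)
    · exact h2
    · exact h1 v hv

theorem vertexWeight_congr {V V' : MarkedTree} {u : Vertex} (h : ∀ v, v <:+ u → V v = V' v) :
    vertexWeight 𝓛 s β V u = vertexWeight 𝓛 s β V' u := by
  by_cases h' : StaysAbove β V u
  · simp [vertexWeight, h', (staysAbove_congr h).1 h', h u List.suffix_rfl]
  · simp [vertexWeight, h', mt (staysAbove_congr h).2 h']

theorem vertexWeight_cut {n : ℕ} {V : MarkedTree} {u : Vertex} (hu : u.length ≤ n) :
    vertexWeight 𝓛 s β (cut n V) u = vertexWeight 𝓛 s β V u :=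
  vertexWeight_congr fun _ hv => cut_of_le (hv.length_le.trans hu)

theorem staysAbove_grow {n : ℕ} {V : MarkedTree} {c : Vertex → Offspring} {u : Vertex}
    (hu : u.length ≤ n) : StaysAbove β (grow n V c) u ↔ StaysAbove β V u :=
  staysAbove_congr fun _ hv => grow_of_le V c (hv.length_le.trans hu)

theorem vertexWeight_of_staysAbove {V : MarkedTree} {u : Vertex} {x : ℝ} (h : StaysAbove β V u)
    (hx : V u = some x) : vertexWeight 𝓛 s β V u = initValue 𝓛 (shift u.length s) β x := by
  simp [vertexWeight, h, hx, initValue]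

theorem vertexWeight_grow_cons {n : ℕ} {V : MarkedTree} {c : Vertex → Offspring} {u : Vertex}
    {x : ℝ} (hu : u.length = n) (h : StaysAbove β V u) (hx : V u = some x) (k : ℕ) :
    vertexWeight 𝓛 s β (grow n V c) (k :: u) = (c u k).elim 0 (childWeight 𝓛 s β n x) := by
  have hg := (staysAbove_grow (c := c) hu.le).2 h
  cases hc : c u k with
  | none =>
    have : ¬ StaysAbove β (grow n V c) (k :: u) := by
      rw [staysAbove_cons, grow_cons V c hu, hx, hc]
      simp [childPos]
    simp [vertexWeight, this]
  | some l =>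
    have hp : grow n V c (k :: u) = some (x + l) := by
      rw [grow_cons V c hu, hx, hc]
      rfl
    have hiff : StaysAbove β (grow n V c) (k :: u) ↔ -β ≤ x + l := by
      rw [staysAbove_cons, hp]
      simp [hg]
    simp only [vertexWeight, hiff, hp, List.length_cons, hu, Option.getD_some, Option.elim_some,
      childWeight]

theorem vertexWeight_grow_cons_of_not {n : ℕ} {V : MarkedTree} {c : Vertex → Offspring} {u : Vertex}
    (hu : u.length = n) (h : ¬ StaysAbove β V u) (k : ℕ) :
    vertexWeight 𝓛 s β (grow n V c) (k :: u) = 0 := by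
  have : ¬ StaysAbove β (grow n V c) (k :: u) := by
    rw [staysAbove_cons, staysAbove_grow hu.le]
    exact fun h' => h h'.1
  simp [vertexWeight, this]

variable (hs : CenteredEnv 𝓛 s) (hfin : ∀ y, 0 ≤ y → harmonic 𝓛 s y ≠ ∞)

include hs in
theorem initValue_ne_zero (n : ℕ) {x : ℝ} (hx : -β ≤ x) : initValue 𝓛 (shift n s) β x ≠ 0 :=
  mul_ne_zero ((hs.shift n).harmonic_ne_zero (by linarith)) (by simpa using Real.exp_pos _)

include hs hfin in
theorem initValue_ne_top (n : ℕ) {x : ℝ} (hx : -β ≤ x) : initValue 𝓛 (shift n s) β x ≠ ∞ :=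
  ENNReal.mul_ne_top (hs.harmonic_shift_ne_top hfin n _ (by linarith)) ENNReal.ofReal_ne_top

include hs in
/-- The weights form a martingale: the one step identity. -/
theorem lintegral_childSum_childWeight (n : ℕ) {x : ℝ} (hx : -β ≤ x) :
    ∫⁻ c, childSum (childWeight 𝓛 s β n x) c ∂𝓛 (s n) = initValue 𝓛 (shift n s) β x := by
  have e : shift 1 (shift n s) = shift (n + 1) s := by
    funext i
    simp only [shift]
    congr 1
    omega
  have e0 : shift n s 0 = s n := by simp [shift]
  have h := (hs.shift n).stepOp_harmonic (y := x + β) (by linarith)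
  rw [e, e0, stepOp] at h
  have hm : Measurable fun l =>
      (Set.Ici 0).indicator (harmonic 𝓛 (shift (n + 1) s)) (x + β + l) :=
    ((measurable_harmonic 𝓛 _).indicator measurableSet_Ici).comp (by fun_prop)
  rw [lintegral_stepLaw 𝓛 _ hm] at h
  have hm' : Measurable fun l => (Set.Ici 0).indicator (harmonic 𝓛 (shift (n + 1) s)) (x + β + l) *
      ENNReal.ofReal (Real.exp (-l)) := hm.mul (by fun_prop)
  rw [initValue, ← h, mul_comm, ← lintegral_const_mul _ (measurable_childSum hm')]
  refine lintegral_congr fun c => ?_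
  rw [← childSum_const_mul]
  congr 1
  funext l
  by_cases hl : -β ≤ x + l
  · have hl' : x + β + l ∈ Set.Ici (0 : ℝ) := by
      change 0 ≤ x + β + l
      linarith
    rw [childWeight, if_pos hl, Set.indicator_of_mem hl', neg_add, Real.exp_add,
      ENNReal.ofReal_mul (Real.exp_nonneg _), add_right_comm x β l]
    ring
  · have hl' : x + β + l ∉ Set.Ici (0 : ℝ) := by
      change ¬ 0 ≤ x + β + l
      intro h
      exact hl (by linarith)
    rw [childWeight, if_neg hl, Set.indicator_of_notMem hl']
    simp

include hs hfin in
-- At positions allowed for the spine, the fallback branch of `biasedOffspring` is never used.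
theorem mem_massOne [IsMarkovKernel 𝓛] (n : ℕ) {x : ℝ} (hx : -β ≤ x) : x ∈ massOne 𝓛 s β n := by
  have hm : Measurable (childSum (childWeight 𝓛 s β n x)) :=
    measurable_childSum ((measurable_childWeight 𝓛 s β n).comp measurable_prodMk_left)
  change ∫⁻ c, childSum (childWeight 𝓛 s β n x) c / initValue 𝓛 (shift n s) β x ∂𝓛 (s n) = 1
  simp only [div_eq_mul_inv]
  rw [lintegral_mul_const _ hm, lintegral_childSum_childWeight hs n hx]
  exact ENNReal.mul_inv_cancel (initValue_ne_zero hs n hx) (initValue_ne_top hs hfin n hx)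

include hs hfin in
theorem lintegral_biasedOffspring [IsMarkovKernel 𝓛] (n : ℕ) {x : ℝ} (hx : -β ≤ x)
    {g : Offspring → ℝ≥0∞} (hg : Measurable g) :
    ∫⁻ c, g c ∂biasedOffspring 𝓛 s β n x =
      ∫⁻ c, biasDensity 𝓛 s β n x c * g c ∂𝓛 (s n) := by
  classical
  have hm := measurable_biasDensity 𝓛 s β n
  rw [biasedOffspring, Kernel.piecewise_apply, if_pos (mem_massOne hs hfin n hx),
    Kernel.withDensity_apply _ hm, Kernel.const_apply]
  exact lintegral_withDensity_eq_lintegral_mul _ (hm.comp measurable_prodMk_left) hg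

end Weights

/-! ### One step of the branching random walk with a spine -/

section Step

variable (𝓛 : Kernel E Offspring) [IsMarkovKernel 𝓛] (s : ℕ → E) (β : ℝ)

/-- The mean of `F` over the choice of the next spine particle among the children of `q.2`. -/
def pickMean (F : MarkedTree × Vertex → ℝ≥0∞) (q : MarkedTree × Vertex) : ℝ≥0∞ :=
  ∑' k, pickProb 𝓛 s β q k * F (q.1, k :: q.2)

omit [IsMarkovKernel 𝓛] in
theorem measurable_pickMean {F : MarkedTree × Vertex → ℝ≥0∞} (hF : Measurable F) :
    Measurable (pickMean 𝓛 s β F) := by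
  refine Measurable.tsum fun k => (measurable_pickProb 𝓛 s β k).mul (hF.comp ?_)
  exact measurable_nextSpine.comp (measurable_id.prodMk measurable_const)

theorem lintegral_spineStep (n : ℕ) (V : MarkedTree) (w : Vertex)
    {F : MarkedTree × Vertex → ℝ≥0∞} (hF : Measurable F) :
    ∫⁻ q, F q ∂spineStep 𝓛 s β n (V, w) =
      ∫⁻ c, ∫⁻ d, pickMean 𝓛 s β F (grow n V (Function.update c w d), w)
        ∂biasedOffspring 𝓛 s β n ((V w).getD 0)
        ∂Measure.infinitePi fun _ : Vertex => 𝓛 (s n) := by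
  have hFn : Measurable fun q : (MarkedTree × Vertex) × ℕ => F (q.1.1, q.2 :: q.1.2) :=
    hF.comp measurable_nextSpine
  have hpick : ∀ q, ∫⁻ r, F (r.1.1, r.2 :: r.1.2) ∂(Kernel.id ×ₖ pickKernel 𝓛 s β) q =
      pickMean 𝓛 s β F q := by
    intro q
    rw [Kernel.lintegral_id_prod hFn]
    change ∫⁻ k, F (q.1, k :: q.2) ∂(Measure.sum fun k => pickProb 𝓛 s β q k • Measure.dirac k) = _
    rw [lintegral_sum_measure]
    simp [pickMean]
  rw [spineStep, Kernel.lintegral_map _ measurable_nextSpine _ hF, Kernel.lintegral_comp _ _ _ hFn]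
  simp only [hpick]
  have hm := measurable_pickMean 𝓛 s β hF
  have hmg : Measurable fun q => pickMean 𝓛 s β F (growSpine n q) :=
    hm.comp (measurable_growSpine n)
  rw [reproKernel, Kernel.lintegral_map _ (measurable_growSpine n) _ hm,
    Kernel.lintegral_id_prod hmg]
  exact Kernel.lintegral_prod _ _ _ (hmg.comp measurable_prodMk_left)

variable {𝓛 s β}

omit [IsMarkovKernel 𝓛] in
-- The total weight of the children is the normalisation in the choice of the spine, so multiplying
-- by it leaves the bare weights. If it is `0`, every weight vanishes and the arbitrary choice is
-- harmless.
theorem pickMean_grow_of_staysAbove {n : ℕ} {V : MarkedTree} {c : Vertex → Offspring} {u : Vertex}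
    {x : ℝ} (hu : u.length = n) (h : StaysAbove β V u) (hx : V u = some x)
    (htop : childSum (childWeight 𝓛 s β n x) (c u) ≠ ∞) (F : MarkedTree × Vertex → ℝ≥0∞) :
    childSum (childWeight 𝓛 s β n x) (c u) * pickMean 𝓛 s β F (grow n V c, u) =
      ∑' k, vertexWeight 𝓛 s β (grow n V c) (k :: u) * F (grow n V c, k :: u) := by
  have ht : totalWeight 𝓛 s β (grow n V c, u) = childSum (childWeight 𝓛 s β n x) (c u) :=
    tsum_congr fun k => vertexWeight_grow_cons hu h hx k
  rw [← ht] at htop ⊢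
  rw [pickMean, ← ENNReal.tsum_mul_left]
  refine tsum_congr fun k => ?_
  rw [← mul_assoc]
  congr 1
  by_cases h0 : totalWeight 𝓛 s β (grow n V c, u) = 0
  · rw [h0, zero_mul]
    exact (ENNReal.tsum_eq_zero.1 h0 k).symm
  · rw [pickProb, if_neg (not_or.2 ⟨h0, htop⟩)]
    exact ENNReal.mul_div_cancel h0 htop

/-- The heart of the spinal decomposition: the biased reproduction and the weighted choice of a
child together turn the weight of `u` into the weights of its children under the unbiased law. If
`u` has gone below `-β` or is absent, both sides are `0`. -/
theorem vertexWeight_mul_lintegral_spineStep (hs : CenteredEnv 𝓛 s)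
    (hfin : ∀ y, 0 ≤ y → harmonic 𝓛 s y ≠ ∞) {n : ℕ} (V : MarkedTree) {u : Vertex}
    (hu : u.length = n) {F : MarkedTree × Vertex → ℝ≥0∞} (hF : Measurable F) :
    vertexWeight 𝓛 s β V u * ∫⁻ q, F q ∂spineStep 𝓛 s β n (V, u) =
      ∫⁻ c, ∑' k, vertexWeight 𝓛 s β (grow n V c) (k :: u) * F (grow n V c, k :: u)
        ∂Measure.infinitePi fun _ : Vertex => 𝓛 (s n) := by
  by_cases h : StaysAbove β V u
  swap
  · simp only [vertexWeight_grow_cons_of_not hu h, zero_mul, tsum_zero, lintegral_zero]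
    simp [vertexWeight, h]
  obtain ⟨x, hx, hβ⟩ := h u List.suffix_rfl
  have hpm : Measurable fun c => pickMean 𝓛 s β F (grow n V c, u) :=
    (measurable_pickMean 𝓛 s β hF).comp
      (((measurable_grow n).comp measurable_prodMk_left).prodMk measurable_const)
  have hbias : Measurable (biasDensity 𝓛 s β n x) :=
    (measurable_biasDensity 𝓛 s β n).comp measurable_prodMk_left
  have hcw : Measurable (childSum (childWeight 𝓛 s β n x)) :=
    measurable_childSum ((measurable_childWeight 𝓛 s β n).comp measurable_prodMk_left)
  have hG : Measurable fun c : Vertex → Offspring =>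
      biasDensity 𝓛 s β n x (c u) * pickMean 𝓛 s β F (grow n V c, u) :=
    (hbias.comp (measurable_pi_apply u)).mul hpm
  have h1 : ∫⁻ q, F q ∂spineStep 𝓛 s β n (V, u) =
      ∫⁻ c, biasDensity 𝓛 s β n x (c u) * pickMean 𝓛 s β F (grow n V c, u)
        ∂Measure.infinitePi fun _ : Vertex => 𝓛 (s n) := by
    rw [lintegral_spineStep 𝓛 s β n V u hF, hx]
    -- Redraw the coordinate `u` on the unbiased side as well; the two sides then differ only by the
    -- bias density of that coordinate.
    conv_rhs => rw [← map_update_infinitePi (fun _ : Vertex => 𝓛 (s n)) u]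
    have hG' := hG.comp (measurable_update_prod (X := Offspring) u)
    rw [lintegral_map hG (measurable_update_prod u)]
    refine Eq.trans ?_ (lintegral_prod _ hG'.aemeasurable).symm
    refine lintegral_congr fun c => ?_
    have hc : Measurable fun d => pickMean 𝓛 s β F (grow n V (Function.update c u d), u) :=
      hpm.comp ((measurable_update_prod u).comp measurable_prodMk_left)
    rw [Option.getD_some, lintegral_biasedOffspring hs hfin n hβ hc]
    simp
  rw [h1, vertexWeight_of_staysAbove h hx, hu, ← lintegral_const_mul _ hG]
  have hint : ∫⁻ c, childSum (childWeight 𝓛 s β n x) (c u)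
      ∂Measure.infinitePi (fun _ : Vertex => 𝓛 (s n)) ≠ ∞ := by
    have := (measurePreserving_eval_infinitePi (fun _ : Vertex => 𝓛 (s n)) u).lintegral_comp hcw
    simp only [Function.eval] at this
    rw [this, lintegral_childSum_childWeight hs n hβ]
    exact initValue_ne_top hs hfin n hβ
  refine lintegral_congr_ae ?_
  -- An infinite total weight would make the choice arbitrary; its mean is finite, so this has
  -- probability zero.
  filter_upwards [ae_lt_top (hcw.comp (measurable_pi_apply u)) hint] with c hc
  rw [← pickMean_grow_of_staysAbove hu h hx hc.ne F, ← mul_assoc]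
  congr 1
  exact ENNReal.mul_div_cancel (initValue_ne_zero hs n hβ) (initValue_ne_top hs hfin n hβ)

end Step

/-! ### The chain -/

section Chain

variable (𝓛 : Kernel E Offspring) [IsMarkovKernel 𝓛] (s : ℕ → E) (β a : ℝ)

instance : IsProbabilityMeasure (spineChain 𝓛 s β a) := by
  unfold spineChain; infer_instance

theorem lintegral_spineChain_zero {F : MarkedTree × Vertex → ℝ≥0∞} (hF : Measurable F) :
    ∫⁻ p, F (p 0) ∂spineChain 𝓛 s β a = F (rootTree a, []) := by
  set κ : (n : ℕ) → Kernel ((i : Finset.Iic n) → MarkedTree × Vertex) (MarkedTree × Vertex) :=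
    fun n => (spineStep 𝓛 s β n).comap (fun h => h ⟨n, Finset.mem_Iic.2 le_rfl⟩)
      (measurable_pi_apply _) with hκ
  have hF0 : Measurable fun p : ℕ → MarkedTree × Vertex => F (p 0) := by fun_prop
  have hF0' : Measurable fun p : (i : Finset.Iic 0) → MarkedTree × Vertex =>
      F (p ⟨0, Finset.mem_Iic.2 le_rfl⟩) := by fun_prop
  have hstart : ∀ h, ∫⁻ p, F (p 0) ∂Kernel.traj (X := fun _ => MarkedTree × Vertex) κ 0 h =
      F (h ⟨0, Finset.mem_Iic.2 le_rfl⟩) := by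
    intro h
    have e := Kernel.traj_map_frestrictLe (X := fun _ => MarkedTree × Vertex) (κ := κ) 0 0
    rw [Kernel.partialTraj_self] at e
    have e1 := congrArg (fun m => ∫⁻ p, F (p ⟨0, Finset.mem_Iic.2 le_rfl⟩) ∂m h) e
    beta_reduce at e1
    rw [Kernel.lintegral_map _ (by fun_prop) _ hF0', Kernel.id_apply,
      lintegral_dirac' _ hF0'] at e1
    exact e1
  change ∫⁻ p, F (p 0) ∂Measure.bind ((Measure.dirac (rootTree a, [])).map
    (MeasurableEquiv.piUnique _).symm) (Kernel.traj (X := fun _ => MarkedTree × Vertex) κ 0) = _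
  rw [Measure.lintegral_bind (Kernel.aemeasurable _) hF0.aemeasurable]
  simp only [hstart]
  rw [lintegral_map hF0' (MeasurableEquiv.measurable _), lintegral_dirac']
  · rfl
  · exact hF0'.comp (MeasurableEquiv.measurable _)

/-- The Markov property at time `n`: the transition kernel reads only the last coordinate of the
history. -/
theorem lintegral_spineChain_pair (n : ℕ)
    {F : (MarkedTree × Vertex) × (MarkedTree × Vertex) → ℝ≥0∞} (hF : Measurable F) :
    ∫⁻ p, F (p n, p (n + 1)) ∂spineChain 𝓛 s β a =
      ∫⁻ p, ∫⁻ q, F (p n, q) ∂spineStep 𝓛 s β n (p n) ∂spineChain 𝓛 s β a := by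
  set κ : (n : ℕ) → Kernel ((i : Finset.Iic n) → MarkedTree × Vertex) (MarkedTree × Vertex) :=
    fun n => (spineStep 𝓛 s β n).comap (fun h => h ⟨n, Finset.mem_Iic.2 le_rfl⟩)
      (measurable_pi_apply _) with hκ
  have h := Kernel.map_frestrictLe_trajMeasure_compProd_eq_map_trajMeasure
    (X := fun _ => MarkedTree × Vertex) (κ := κ) (μ₀ := Measure.dirac (rootTree a, [])) (a := n)
  have hT : spineChain 𝓛 s β a = Kernel.trajMeasure (X := fun _ => MarkedTree × Vertex)
    (Measure.dirac (rootTree a, [])) κ := rfl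
  rw [← hT] at h
  have hm : Measurable fun r : ((i : Finset.Iic n) → MarkedTree × Vertex) × (MarkedTree × Vertex) =>
      F (r.1 ⟨n, Finset.mem_Iic.2 le_rfl⟩, r.2) := hF.comp (by fun_prop)
  have h2 := congrArg (fun m => ∫⁻ r, F (r.1 ⟨n, Finset.mem_Iic.2 le_rfl⟩, r.2) ∂m) h
  beta_reduce at h2
  rw [lintegral_map hm (by fun_prop), Measure.lintegral_compProd hm, lintegral_map _ (by fun_prop)] at h2
  · exact h2.symm
  · exact hm.lintegral_kernel_prod_right'

end Chain

/-! ### The law of the chain in terms of the branching random walk -/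

/-- A vertex of generation `n + 1` is a child of a vertex of generation `n`. -/
def childEquiv (n : ℕ) : {u : Vertex // u.length = n} × ℕ ≃ {v : Vertex // v.length = n + 1} where
  toFun p := ⟨p.2 :: p.1.1, by simp [p.1.2]⟩
  invFun
    | ⟨k :: u, h⟩ => (⟨u, by simpa using h⟩, k)
  left_inv _ := rfl
  right_inv
    | ⟨_ :: _, _⟩ => rfl

theorem tsum_vertex_succ (n : ℕ) (f : Vertex → ℝ≥0∞) :
    ∑' v : {v : Vertex // v.length = n + 1}, f v =
      ∑' u : {u : Vertex // u.length = n}, ∑' k, f (k :: u.1) := by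
  rw [← (childEquiv n).tsum_eq (fun v => f v.1)]
  exact ENNReal.tsum_prod (f := fun (u : {u : Vertex // u.length = n}) k => f (k :: u.1))

section Chain

variable {𝓛 : Kernel E Offspring} [IsMarkovKernel 𝓛] {s : ℕ → E} {β a : ℝ}

/-- Induction on `n` by the Markov property and the branching property. Each vertex of generation
`n` is handled by the one-step identity, and its children are regrouped into generation `n + 1`. -/
theorem lintegral_spineChain (hs : CenteredEnv 𝓛 s)
    (hfin : ∀ y, 0 ≤ y → harmonic 𝓛 s y ≠ ∞) (ha : -β ≤ a) (n : ℕ) :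
    ∀ {F : MarkedTree × Vertex → ℝ≥0∞}, Measurable F →
      ∫⁻ p, F (p n) ∂spineChain 𝓛 s β a =
        (initValue 𝓛 s β a)⁻¹ * ∫⁻ V, ∑' u : {u : Vertex // u.length = n},
          vertexWeight 𝓛 s β V u * F (V, u) ∂cutLaw 𝓛 s a n := by
  have h0 : initValue 𝓛 s β a ≠ 0 := initValue_ne_zero hs 0 ha
  have htop : initValue 𝓛 s β a ≠ ∞ := initValue_ne_top hs hfin 0 ha
  have hmeas : ∀ (F : MarkedTree × Vertex → ℝ≥0∞), Measurable F → ∀ u : Vertex,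
      Measurable fun V => vertexWeight 𝓛 s β V u * F (V, u) := fun F hF u =>
    (measurable_vertexWeight 𝓛 s β u).mul (hF.comp measurable_prodMk_right)
  induction n with
  | zero =>
    intro F hF
    have hsum : ∀ V : MarkedTree, ∑' u : {u : Vertex // u.length = 0},
        vertexWeight 𝓛 s β V u * F (V, u) = vertexWeight 𝓛 s β V [] * F (V, []) := by
      intro V
      rw [tsum_eq_single (⟨[], rfl⟩ : {u : Vertex // u.length = 0})]
      rintro ⟨u, hu⟩ hne
      exact absurd (Subtype.ext (List.length_eq_zero_iff.1 hu)) hne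
    have hst : StaysAbove β (rootTree a) [] := by
      intro v hv
      rw [List.suffix_nil.1 hv]
      exact ⟨a, rfl, ha⟩
    rw [lintegral_spineChain_zero 𝓛 s β a hF]
    simp only [hsum]
    rw [cutLaw_zero, lintegral_dirac' _ (hmeas F hF []),
      vertexWeight_of_staysAbove hst rfl, ← mul_assoc]
    have e : initValue 𝓛 (shift (List.length ([] : Vertex)) s) β a = initValue 𝓛 s β a := rfl
    rw [e, ENNReal.inv_mul_cancel h0 htop, one_mul]
  | succ n ih =>
    intro F hF
    have hF2 : Measurable fun r : (MarkedTree × Vertex) × (MarkedTree × Vertex) => F r.2 :=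
      hF.comp measurable_snd
    have hG : Measurable fun q => ∫⁻ r, F r ∂spineStep 𝓛 s β n q := hF.lintegral_kernel
    have e : ∫⁻ p, F (p (n + 1)) ∂spineChain 𝓛 s β a =
        ∫⁻ p, ∫⁻ q, F q ∂spineStep 𝓛 s β n (p n) ∂spineChain 𝓛 s β a :=
      lintegral_spineChain_pair 𝓛 s β a n hF2
    rw [e, ih hG]
    congr 1
    have hS : Measurable fun V => ∑' u : {u : Vertex // u.length = n + 1},
        vertexWeight 𝓛 s β V u * F (V, u) := Measurable.tsum fun u => hmeas F hF u
    rw [lintegral_cutLaw_succ 𝓛 s a n hS]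
    refine lintegral_congr fun V => ?_
    have hk : ∀ u : Vertex, Measurable fun c : Vertex → Offspring =>
        ∑' k, vertexWeight 𝓛 s β (grow n V c) (k :: u) * F (grow n V c, k :: u) := fun u =>
      Measurable.tsum fun k => (hmeas F hF (k :: u)).comp
        ((measurable_grow n).comp measurable_prodMk_left)
    have hsum : ∀ c, ∑' u : {u : Vertex // u.length = n + 1},
        vertexWeight 𝓛 s β (grow n V c) u * F (grow n V c, u) =
        ∑' u : {u : Vertex // u.length = n}, ∑' k,
          vertexWeight 𝓛 s β (grow n V c) (k :: u.1) * F (grow n V c, k :: u.1) := fun c =>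
      tsum_vertex_succ n fun u => vertexWeight 𝓛 s β (grow n V c) u * F (grow n V c, u)
    simp only [hsum]
    rw [lintegral_tsum fun u : {u : Vertex // u.length = n} => (hk u).aemeasurable]
    exact tsum_congr fun u => vertexWeight_mul_lintegral_spineStep hs hfin V u.2 hF

theorem measurableSet_eq_option : MeasurableSet {q : Option ℝ × Option ℝ | q.1 = q.2} := by
  have e : {q : Option ℝ × Option ℝ | q.1 = q.2} =
      (Prod.fst ⁻¹' {none} ∩ Prod.snd ⁻¹' {none}) ∪ ((Prod.fst ⁻¹' {none}ᶜ ∩ Prod.snd ⁻¹' {none}ᶜ) ∩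
        {q | q.1.getD 0 = q.2.getD 0}) := by
    ext ⟨x, y⟩
    cases x <;> cases y <;> simp
  have hn := measurableSet_none
  rw [e]
  exact ((measurable_fst hn).inter (measurable_snd hn)).union
    (((measurable_fst hn.compl).inter (measurable_snd hn.compl)).inter
      (measurableSet_eq_fun (measurable_getD.comp measurable_fst)
        (measurable_getD.comp measurable_snd)))

variable (𝓛 s β a) in
-- A step only adds generation `n + 1`, so the event of a change at an earlier vertex is null under
-- the joint law of two successive states.
theorem ae_spineChain_eq (n : ℕ) : ∀ᵐ p ∂spineChain 𝓛 s β a,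
    ∀ u : Vertex, u.length ≤ n → (p (n + 1)).1 u = (p n).1 u := by
  rw [ae_all_iff]
  intro u
  by_cases hu : u.length ≤ n
  swap
  · exact ae_of_all _ fun p h => absurd h hu
  set D : Set ((MarkedTree × Vertex) × (MarkedTree × Vertex)) := {r | r.2.1 u = r.1.1 u}ᶜ with hD
  have hDm : MeasurableSet D := by
    have hm : Measurable fun r : (MarkedTree × Vertex) × (MarkedTree × Vertex) =>
        (r.2.1 u, r.1.1 u) := by fun_prop
    exact (hm measurableSet_eq_option).compl
  have hF : Measurable (D.indicator fun _ => (1 : ℝ≥0∞)) := measurable_const.indicator hDm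
  have h := lintegral_spineChain_pair 𝓛 s β a n hF
  have hz : ∀ q : MarkedTree × Vertex,
      ∫⁻ r, D.indicator (fun _ => (1 : ℝ≥0∞)) (q, r) ∂spineStep 𝓛 s β n q = 0 := by
    rintro ⟨V, w⟩
    have hFq : Measurable fun r => D.indicator (fun _ => (1 : ℝ≥0∞)) ((V, w), r) :=
      hF.comp measurable_prodMk_left
    rw [lintegral_spineStep 𝓛 s β n V w hFq]
    have : ∀ c d, pickMean 𝓛 s β (fun r => D.indicator (fun _ => (1 : ℝ≥0∞)) ((V, w), r))
        (grow n V (Function.update c w d), w) = 0 := by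
      intro c d
      refine ENNReal.tsum_eq_zero.2 fun k => ?_
      beta_reduce
      rw [Set.indicator_of_notMem, mul_zero]
      simp [hD, grow_of_le V _ hu]
    simp [this]
  simp only [hz, lintegral_zero] at h
  have hm2 : Measurable fun p : ℕ → MarkedTree × Vertex => (p n, p (n + 1)) := by fun_prop
  have h2 := (lintegral_eq_zero_iff (hF.comp hm2)).1 h
  filter_upwards [h2] with p hp _
  by_contra hne
  have : (p n, p (n + 1)) ∈ D := hne
  simp [this] at hp

variable (𝓛 s β a) in
theorem ae_cut_assemble (n : ℕ) : ∀ᵐ p ∂spineChain 𝓛 s β a,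
    ∀ u : Vertex, u.length ≤ n → (assemble p).1 u = (p n).1 u := by
  filter_upwards [ae_all_iff.2 (ae_spineChain_eq 𝓛 s β a)] with p hp u hu
  induction n, hu using Nat.le_induction with
  | base => rfl
  | succ n hn ih => rw [ih, hp n u hn]

/-! ### The tilted law -/

/-- The sets invariant under `cut n` form a σ-algebra that contains the generators of `genSigma n`.
-/
theorem mem_iff_of_measurableSet_genSigma {n : ℕ} {A : Set MarkedTree}
    (hA : MeasurableSet[genSigma n] A) {V V' : MarkedTree}
    (h : ∀ u : Vertex, u.length ≤ n → V u = V' u) : V ∈ A ↔ V' ∈ A := by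
  have hle : genSigma n ≤ MeasurableSpace.invariants (cut n) := by
    refine iSup₂_le fun u hu => ?_
    rintro _ ⟨B, hB, rfl⟩
    refine ⟨measurable_pi_apply u hB, ?_⟩
    ext V
    simp [cut_of_le (show u.length ≤ n from hu)]
  have hinv := (hle A hA).2
  have e : cut n V = cut n V' := by
    funext u
    by_cases hu : u.length ≤ n
    · rw [cut_of_le hu, cut_of_le hu, h u hu]
    · simp [cut, hu]
  rw [← hinv, Set.mem_preimage, Set.mem_preimage, e]

theorem genSigma_le (n : ℕ) : genSigma n ≤ MeasurableSpace.pi := cylinderEvents_le_pi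

theorem genSigma_mono {m n : ℕ} (h : m ≤ n) : genSigma m ≤ genSigma n :=
  cylinderEvents_mono fun _ hu => le_trans hu h

/-- An event of the first `n` generations can be read off the chain at time `n`. Applying the
formula for the chain to a function that ignores the spine leaves the sum of all weights, which is
the truncated martingale. -/
theorem isTiltedLaw_spineLaw (hs : CenteredEnv 𝓛 s)
    (hfin : ∀ y, 0 ≤ y → harmonic 𝓛 s y ≠ ∞) (ha : -β ≤ a) :
    IsTiltedLaw 𝓛 s β a (spineLaw 𝓛 s β a).fst := by
  have hp : IsProbabilityMeasure (spineLaw 𝓛 s β a) :=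
    Measure.isProbabilityMeasure_map measurable_assemble.aemeasurable
  refine ⟨inferInstance, fun n _ A hA => ?_⟩
  have hA' : MeasurableSet A := genSigma_le n A hA
  have hF : Measurable fun q : MarkedTree × Vertex => A.indicator (fun _ => (1 : ℝ≥0∞)) q.1 :=
    (measurable_const.indicator hA').comp measurable_fst
  have hS : Measurable fun V => ∑' u : {u : Vertex // u.length = n},
      vertexWeight 𝓛 s β V u * A.indicator (fun _ => (1 : ℝ≥0∞)) V :=
    Measurable.tsum fun u => (measurable_vertexWeight 𝓛 s β u).mul (measurable_const.indicator hA')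
  have hT : Measurable fun V => truncMart 𝓛 s β n V :=
    Measurable.tsum fun u => measurable_vertexWeight 𝓛 s β u
  calc (spineLaw 𝓛 s β a).fst A
      = ∫⁻ p, A.indicator (fun _ => (1 : ℝ≥0∞)) (assemble p).1 ∂spineChain 𝓛 s β a := by
        rw [Measure.fst_apply hA', spineLaw,
          Measure.map_apply measurable_assemble (measurable_fst hA'),
          ← lintegral_indicator_one (measurable_assemble (measurable_fst hA'))]
        rfl
    _ = ∫⁻ p, A.indicator (fun _ => (1 : ℝ≥0∞)) (p n).1 ∂spineChain 𝓛 s β a := by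
        refine lintegral_congr_ae ?_
        filter_upwards [ae_cut_assemble 𝓛 s β a n] with p hp
        have := mem_iff_of_measurableSet_genSigma hA hp
        by_cases hpA : (p n).1 ∈ A
        · simp [hpA, this.2 hpA]
        · simp [hpA, mt this.1 hpA]
    _ = (initValue 𝓛 s β a)⁻¹ * ∫⁻ V, ∑' u : {u : Vertex // u.length = n},
          vertexWeight 𝓛 s β V u * A.indicator (fun _ => (1 : ℝ≥0∞)) V ∂cutLaw 𝓛 s a n :=
        lintegral_spineChain hs hfin ha n hF
    _ = (initValue 𝓛 s β a)⁻¹ * ∫⁻ V, A.indicator (truncMart 𝓛 s β n) V ∂brwLaw 𝓛 s a := by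
        rw [cutLaw, lintegral_map hS (measurable_cut n)]
        congr 1
        refine lintegral_congr fun V => ?_
        have := mem_iff_of_measurableSet_genSigma hA
          (V := cut n V) (V' := V) fun u hu => cut_of_le hu
        by_cases hV : V ∈ A
        · simp only [Set.indicator_of_mem hV, Set.indicator_of_mem (this.2 hV), mul_one]
          exact tsum_congr fun u => vertexWeight_cut u.2.le
        · simp [Set.indicator_of_notMem hV, Set.indicator_of_notMem (mt this.1 hV)]
    _ = ∫⁻ V in A, truncMart 𝓛 s β n V / initValue 𝓛 s β a ∂brwLaw 𝓛 s a := by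
        simp only [div_eq_mul_inv]
        rw [lintegral_indicator hA', lintegral_mul_const _ hT, mul_comm]

omit [IsMarkovKernel 𝓛] in
-- The events depending on finitely many generations form a π-system, because the σ-algebras
-- increase, and they generate. Restricting to `n ≥ 1` loses nothing, since the root is visible in
-- `genSigma 1`.
theorem IsTiltedLaw.unique {Q Q' : Measure MarkedTree} (h : IsTiltedLaw 𝓛 s β a Q)
    (h' : IsTiltedLaw 𝓛 s β a Q') : Q = Q' := by
  have := h.isProbabilityMeasure
  have := h'.isProbabilityMeasure
  refine ext_of_generate_finite {A | ∃ n, 1 ≤ n ∧ MeasurableSet[genSigma n] A} ?_ ?_ ?_ (by simp)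
  · refine le_antisymm (iSup_le fun u => ?_) (MeasurableSpace.generateFrom_le ?_)
    · rintro _ ⟨B, hB, rfl⟩
      refine MeasurableSpace.measurableSet_generateFrom ⟨max u.length 1, le_max_right _ _, ?_⟩
      have hu : u ∈ {v : Vertex | v.length ≤ max u.length 1} := le_max_left u.length 1
      exact measurable_cylinderEvent_apply hu hB
    · rintro A ⟨n, -, hA⟩
      exact genSigma_le n A hA
  · rintro A ⟨m, hm, hA⟩ B ⟨n, hn, hB⟩ -
    refine ⟨max m n, hm.trans (le_max_left _ _), ?_⟩
    exact MeasurableSet.inter (genSigma_mono (le_max_left _ _) A hA)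
      (genSigma_mono (le_max_right _ _) B hB)
  · rintro A ⟨n, hn, hA⟩
    rw [h.density n hn A hA, h'.density n hn A hA]

end Chain

end

end BRW

theorem mainTheorem5 {E Ω : Type*} [MeasurableSpace E] [MeasurableSpace Ω]
    (P : Measure Ω) [IsProbabilityMeasure P]
    (𝓛 : Kernel E BRW.Offspring) [IsMarkovKernel 𝓛]
    (ξ : ℕ → Ω → E) (hξm : ∀ n, Measurable (ξ n)) (hξi : iIndepFun ξ P)
    (hξd : ∀ n, IdentDistrib (ξ n) (ξ 0) P P)
    (hsurvive : ∀ᵐ ω ∂P, ∀ᵐ c ∂𝓛 (ξ 0 ω), ∃ k, c k ≠ none)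
    (hbranch : 0 < P {ω | 0 < 𝓛 (ξ 0 ω) {c | ∃ j k, j ≠ k ∧ c j ≠ none ∧ c k ≠ none}})
    (hpos : ∀ᵐ ω ∂P, 0 < ∫⁻ c, BRW.childSum
      (fun x => if 0 < x then ENNReal.ofReal (Real.exp (-x)) else 0) c ∂𝓛 (ξ 0 ω))
    (hboundary₀ : ∀ᵐ ω ∂P,
      ∫⁻ c, BRW.childSum (fun x => ENNReal.ofReal (Real.exp (-x))) c ∂𝓛 (ξ 0 ω) = 1)
    (hboundary₁ : ∀ᵐ ω ∂P,
      ∫ c, ∑' k, (c k).elim 0 (fun x : ℝ => x * Real.exp (-x)) ∂𝓛 (ξ 0 ω) = 0)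
    (hmoment : ∃ δ : ℝ, 0 < δ ∧ ∫⁻ ω, ∫⁻ c, BRW.childSum
      (fun x => ENNReal.ofReal (|x| ^ (2 + δ) * Real.exp (-x))) c ∂𝓛 (ξ 0 ω) ∂P < ∞) :
    ∀ᵐ ω ∂P, ∀ β : ℝ, 0 ≤ β → ∀ a : ℝ, 0 ≤ a →
      (∃! Q : Measure BRW.MarkedTree, BRW.IsTiltedLaw 𝓛 (fun n => ξ n ω) β a Q) ∧
      ∀ Q : Measure BRW.MarkedTree, BRW.IsTiltedLaw 𝓛 (fun n => ξ n ω) β a Q →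
        (BRW.spineLaw 𝓛 (fun n => ξ n ω) β a).fst = Q := by
  obtain ⟨δ, hδ, hmoment⟩ := hmoment
  -- The exceptional null set is chosen before `β` and `a`: finiteness of `U` is known for all `y ≥
  -- 0` in one fixed environment.
  filter_upwards [BRW.ae_centeredEnv_and_harmonic_ne_top 𝓛 hξi hξd hpos hboundary₀ hboundary₁ hδ
    hmoment] with ω ⟨hs, hfin⟩ β hβ a ha
  have h := BRW.isTiltedLaw_spineLaw hs hfin (β := β) (a := a) (by linarith)
  exact ⟨⟨_, h, fun Q hQ => hQ.unique h⟩, fun Q hQ => h.unique hQ⟩
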